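/- **Setting.** Let $n\ge 1$, $m\ge 0$, let $Q\in\mathbb R^{n\times n}$ be diagonal and positive semidefinite, $A\in\mathbb R^{m\times n}$, $b\in\mathbb R^m$, $c\in\mathbb R^n$, and consider the pair (P) $\min_x \tfrac12x^TQx+c^Tx$ s.t. $Ax=b$, $x\ge0$, and (D) $\max_{x,y,z} b^Ty-\tfrac12x^TQx$ s.t. $A^Ty+z=Qx+c$, $z\ge0$. Define the seminorm $\|(p,q)\|_{\mathcal A}=\min\{\|(x,z)\|_2 : Ax=p,\ -Qx+A^Ty+z=q\}$. **Algorithm (inexact IP-PMM with $\rho_k=\delta_k=\mu_k$).** Fix parameters $0<\sigma_{\min}\le\sigma_{\max}\le 0.5$, $C_N>0$, $\gamma_{\mathcal A},\gamma_\mu\in(0,1)$, $\rho>0$. Start from $x^0=z^0=\rho\mathbf 1_n$, an arbitrary $y^0$, $\zeta^0=x^0$, $\lambda^0=y^0$, and let $\bar b=Ax^0-b$, $\bar c=-Qx^0+A^Ty^0+z^0-c$. Throughout $\mu_k=(x^k)^Tz^k/n$. The neighborhood $\mathcal N_\mu(\zeta,\lambda)$ is the set of $(x,y,z)$ with $x,z>0$,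 $x_iz_i\ge\gamma_\mu\mu$ for all $i$, and $$Ax+\mu(y-\lambda)=b+\tfrac{\mu}{\mu_0}(\bar b+\tilde b),\qquad -Qx+A^Ty+z-\mu(x-\zeta)=c+\tfrac{\mu}{\mu_0}(\bar c+\tilde c)$$ for some $\tilde b,\tilde c$ with $\|(\tilde b,\tilde c)\|_2\le C_N$, $\|(\tilde b,\tilde c)\|_{\mathcal A}\le\gamma_{\mathcal A}\rho$. Iteration $k$ chooses $\sigma_k\in[\sigma_{\min},\sigma_{\max}]$ and a direction $(\Delta x^k,\Delta y^k,\Delta z^k)$ with $$\begin{aligned} -(Q+\mu_kI)\Delta x^k+A^T\Delta y^k+\Delta z^k&=-\big[-(c+\tfrac{\sigma_k\mu_k}{\mu_0}\bar c)-Qx^k+A^Ty^k+z^k-\sigma_k\mu_k(x^k-\zeta^k)\big]+\varrho_d^k,\\ A\Delta x^k+\mu_k\Delta y^k&=-\big[Ax^k+\sigma_k\mu_k(y^k-\lambda^k)-(b+\tfrac{\sigma_k\mu_k}{\mu_0}\bar b)\big]+\varrho_p^k,\\ z^k_i\Delta x^k_i+x^k_i\Delta z^k_i&=-\big[x^k_iz^k_i-\sigma_k\mu_k\big]+(\varrho_\mu^k)_i\quad(1\le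 i\le n). \end{aligned}$$ A stepsize $\alpha\in(0,1]$ is *admissible* for this direction if, with $(x(\alpha),y(\alpha),z(\alpha))=(x^k,y^k,z^k)+\alpha(\Delta x^k,\Delta y^k,\Delta z^k)$ and $\mu_k(\alpha)=x(\alpha)^Tz(\alpha)/n$, one has $\mu_k(\alpha)\le(1-0.01\alpha)\mu_k$ and $(x(\alpha),y(\alpha),z(\alpha))\in\mathcal N_{\mu_k(\alpha)}(\zeta^k,\lambda^k)$. The algorithm takes the largest admissible stepsize $\alpha_k$ and sets $(x^{k+1},y^{k+1},z^{k+1})=(x(\alpha_k),y(\alpha_k),z(\alpha_k))$. With $\tilde r_p=Ax^{k+1}-b-\tfrac{\mu_{k+1}}{\mu_0}\bar b$ and $\tilde r_d=-Qx^{k+1}+A^Ty^{k+1}+z^{k+1}-c-\tfrac{\mu_{k+1}}{\mu_0}\bar c$, it sets $(\zeta^{k+1},\lambda^{k+1})=(x^{k+1},y^{k+1})$ if $\|(\tilde r_p,\tilde r_d)\|_2\le C_N\mu_{k+1}/\mu_0$ and $\|(\tilde r_p,\tilde r_d)\|_{\mathcal A}\le\gamma_{\mathcal A}\rho\,\mu_{k+1}/\mu_0$,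 and $(\zeta^{k+1},\lambda^{k+1})=(\zeta^k,\lambda^k)$ otherwise. **Assumptions.** 1. At each iteration $\varrho_\mu^k=0$, $\|(\varrho_p^k,\varrho_d^k)\|_2\le\frac{\sigma_{\min}}{4\mu_0}C_N\mu_k$ and $\|(\varrho_p^k,\varrho_d^k)\|_{\mathcal A}\le\frac{\sigma_{\min}}{4\mu_0}\gamma_{\mathcal A}\rho\,\mu_k$. 2. There are $x^*,y^*,z^*$ such that $x^*$ is optimal for (P), $(x^*,y^*,z^*)$ is optimal for (D), and $\|x^*\|_\infty,\|y^*\|_\infty,\|z^*\|_\infty\le C^*$. 3. $\operatorname{rank}A=m$, the $m$ singular values of $A$ lie in $[C_{\min},C_{\max}]$, the eigenvalues of $Q$ are at most $C_Q$, and $\|(c,b)\|_\infty\le C_r$. Moreover $\|y^0\|_\infty\le C_y$. Here $C^*,C_y\ge0$ and $C_{\min},C_{\max},C_Q,C_r>0$. **Theorem.** There is a constant $\bar\kappa>0$, depending only on $\sigma_{\min},\sigma_{\max},C_N,\gamma_{\mathcal A},\gamma_\mu,\rho,C^*,C_{\min},C_{\max},C_Q,C_r,C_y$ (in particular independent of $n$,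 $m$, $k$ and $\epsilon$), such that for all data satisfying Assumptions 2 and 3 and all iterates generated by inexact IP-PMM under Assumption 1 the following holds. (a) At every iteration $k$, and for every direction allowed there, every $\alpha\in(0,\bar\kappa/n^4]$ is an admissible stepsize. (b) Let $\epsilon\in(0,1)$ and let $C,\omega>0$ be such that $\mu_0\le C/\epsilon^{\omega}$. Then $\mu_k\le\epsilon$ for every iteration index $$k\ \ge\ \frac{n^4}{0.01\,\bar\kappa}\Big[(1+\omega)\log\tfrac1\epsilon+\log C\Big].$$ (c) For fixed $C,\omega>0$, the bound in (b) is $O\big(n^4\log\frac1\epsilon\big)$ as $\epsilon\to0^+$, uniformly in $n$. -/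

import Mathlib

open Filter Topology Asymptotics Matrix

namespace IPPMM

/-- Data of the quadratic program pair
(P) minimize `½ xᵀQx + cᵀx` subject to `Ax = b`, `x ≥ 0`;
(D) maximize `bᵀy - ½ xᵀQx` subject to `Aᵀy + z = Qx + c`, `z ≥ 0`. -/
structure QP (n m : ℕ) where
  Q : Matrix (Fin n) (Fin n) ℝ
  A : Matrix (Fin m) (Fin n) ℝ
  b : Fin m → ℝ
  c : Fin n → ℝ

namespace QP

variable {n m : ℕ} (P : QP n m)

/-- The problem is convex and separable: `Q` is diagonal and positive semidefinite. -/
def SeparableConvex : Prop := P.Q.IsDiag ∧ P.Q.PosSemidef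

noncomputable def primalObj (x : Fin n → ℝ) : ℝ := (1 / 2) * (x ⬝ᵥ P.Q *ᵥ x) + P.c ⬝ᵥ x

noncomputable def dualObj (x : Fin n → ℝ) (y : Fin m → ℝ) : ℝ :=
  P.b ⬝ᵥ y - (1 / 2) * (x ⬝ᵥ P.Q *ᵥ x)

def PrimalFeasible (x : Fin n → ℝ) : Prop := P.A *ᵥ x = P.b ∧ 0 ≤ x

def DualFeasible (x : Fin n → ℝ) (y : Fin m → ℝ) (z : Fin n → ℝ) : Prop :=
  P.Aᵀ *ᵥ y + z = P.Q *ᵥ x + P.c ∧ 0 ≤ z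

/-- `(x, y, z)` is an optimal solution of the pair: `x` is optimal for (P) and `(x, y, z)` is
optimal for (D). -/
def IsOptimal (x : Fin n → ℝ) (y : Fin m → ℝ) (z : Fin n → ℝ) : Prop :=
  (P.PrimalFeasible x ∧ ∀ x', P.PrimalFeasible x' → P.primalObj x ≤ P.primalObj x') ∧
  (P.DualFeasible x y z ∧ ∀ x' y' z', P.DualFeasible x' y' z' → P.dualObj x' y' ≤ P.dualObj x y)

/-- The pair has an optimal solution that is bounded by `Cstar` in the maximum norm (which is the
norm `‖·‖` of the function space `Fin n → ℝ`). -/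
def BoundedOptimalSolution (Cstar : ℝ) : Prop :=
  ∃ (x : Fin n → ℝ) (y : Fin m → ℝ) (z : Fin n → ℝ),
    P.IsOptimal x y z ∧ ‖x‖ ≤ Cstar ∧ ‖y‖ ≤ Cstar ∧ ‖z‖ ≤ Cstar

/-- `A` has full row rank, its `m` singular values lie in `[Cmin, Cmax]` (`singularValues` lists
the singular values in decreasing order and continues with zeros), the eigenvalues of `Q` are at
most `CQ`, and the entries of `c` and `b` are at most `Cr` in absolute value. -/
def RegularData (Cmin Cmax CQ Cr : ℝ) : Prop :=
  P.A.rank = m ∧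
  (∀ i < m, Cmin ≤ (Matrix.toEuclideanLin P.A).singularValues i ∧
    (Matrix.toEuclideanLin P.A).singularValues i ≤ Cmax) ∧
  (∀ t ∈ spectrum ℝ P.Q, t ≤ CQ) ∧ ‖P.c‖ ≤ Cr ∧ ‖P.b‖ ≤ Cr

end QP

/-- The Euclidean norm of the stacked vector `(u, v)`. -/
noncomputable def pairNorm {p q : ℕ} (u : Fin p → ℝ) (v : Fin q → ℝ) : ℝ :=
  Real.sqrt (u ⬝ᵥ u + v ⬝ᵥ v)

/-- The seminorm `‖(b, c)‖_𝒜`: the least Euclidean norm of `(x, z)` over all `(x, y, z)` with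
`Ax = b` and `-Qx + Aᵀy + z = c`. -/
noncomputable def semiNorm {n m : ℕ} (P : QP n m) (b : Fin m → ℝ) (c : Fin n → ℝ) : ℝ :=
  sInf {t : ℝ | ∃ (x : Fin n → ℝ) (y : Fin m → ℝ) (z : Fin n → ℝ),
    P.A *ᵥ x = b ∧ -(P.Q *ᵥ x) + P.Aᵀ *ᵥ y + z = c ∧ t = pairNorm x z}

/-- The parameters of the algorithm, together with the size `ρ` of the starting point. -/
structure Params where
  σmin : ℝ
  σmax : ℝ
  CN : ℝ
  γA : ℝ
  γμ : ℝ
  ρ : ℝ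

def Params.Valid (par : Params) : Prop :=
  (0 < par.σmin ∧ par.σmin ≤ par.σmax ∧ par.σmax ≤ 1 / 2) ∧ 0 < par.CN ∧
  (0 < par.γA ∧ par.γA < 1) ∧ (0 < par.γμ ∧ par.γμ < 1) ∧ 0 < par.ρ

/-- A primal-dual triple `(x, y, z)`. -/
structure Triple (n m : ℕ) where
  x : Fin n → ℝ
  y : Fin m → ℝ
  z : Fin n → ℝ

namespace Triple

variable {n m : ℕ}

/-- The duality measure `xᵀz / n`. -/
noncomputable def mu (w : Triple n m) : ℝ := (w.x ⬝ᵥ w.z) / n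

/-- The point `w + α d`. -/
def move (w : Triple n m) (α : ℝ) (d : Triple n m) : Triple n m :=
  ⟨w.x + α • d.x, w.y + α • d.y, w.z + α • d.z⟩

end Triple

/-- The current iterate with the current estimates `ζ` of the primal solution and `lam` of the
multiplier. -/
structure State (n m : ℕ) where
  pt : Triple n m
  ζ : Fin n → ℝ
  lam : Fin m → ℝ

/-- A problem, the parameters, and the free part `y0` of the starting point. -/
structure Instance (n m : ℕ) where
  P : QP n m
  par : Params
  y0 : Fin m → ℝ

namespace Instance

variable {n m : ℕ} (I : Instance n m)

/-- The starting point: `x⁰ = z⁰ = ρ (1, …, 1)`, with the given `y⁰`. -/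
def start : Triple n m := ⟨fun _ => I.par.ρ, I.y0, fun _ => I.par.ρ⟩

noncomputable def mu0 : ℝ := I.start.mu

/-- `b̄`, given by `A x⁰ = b + b̄`. -/
def bbar : Fin m → ℝ := I.P.A *ᵥ I.start.x - I.P.b

/-- `c̄`, given by `-Q x⁰ + Aᵀ y⁰ + z⁰ = c + c̄`. -/
def cbar : Fin n → ℝ := -(I.P.Q *ᵥ I.start.x) + I.P.Aᵀ *ᵥ I.start.y + I.start.z - I.P.c

/-- The neighborhood `𝒩_μ(ζ, lam)`. -/
def nbhd (μ : ℝ) (ζ : Fin n → ℝ) (lam : Fin m → ℝ) : Set (Triple n m) :=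
  {w | (∃ (bt : Fin m → ℝ) (ct : Fin n → ℝ),
      I.P.A *ᵥ w.x + μ • (w.y - lam) = I.P.b + (μ / I.mu0) • (I.bbar + bt) ∧
      -(I.P.Q *ᵥ w.x) + I.P.Aᵀ *ᵥ w.y + w.z - μ • (w.x - ζ)
        = I.P.c + (μ / I.mu0) • (I.cbar + ct) ∧
      pairNorm bt ct ≤ I.par.CN ∧ semiNorm I.P bt ct ≤ I.par.γA * I.par.ρ) ∧
    ∀ i, 0 < w.x i ∧ 0 < w.z i ∧ I.par.γμ * μ ≤ w.x i * w.z i}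

/-- `d` solves the Newton system at the state `s` with centering parameter `σ` and residuals
`(rd, rp, rμ)`. The regularization parameters are `ρ_k = δ_k = μ_k`. -/
def Newton (s : State n m) (σ : ℝ) (d : Triple n m)
    (rd : Fin n → ℝ) (rp : Fin m → ℝ) (rμ : Fin n → ℝ) : Prop :=
  -(I.P.Q *ᵥ d.x + s.pt.mu • d.x) + I.P.Aᵀ *ᵥ d.y + d.z
    = -(-(I.P.c + (σ * s.pt.mu / I.mu0) • I.cbar) - I.P.Q *ᵥ s.pt.x + I.P.Aᵀ *ᵥ s.pt.y + s.pt.z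
        - (σ * s.pt.mu) • (s.pt.x - s.ζ)) + rd ∧
  I.P.A *ᵥ d.x + s.pt.mu • d.y
    = -(I.P.A *ᵥ s.pt.x + (σ * s.pt.mu) • (s.pt.y - s.lam)
        - (I.P.b + (σ * s.pt.mu / I.mu0) • I.bbar)) + rp ∧
  s.pt.z * d.x + s.pt.x * d.z = -(s.pt.x * s.pt.z - fun _ => σ * s.pt.mu) + rμ

/-- The bounds that the residuals of the Newton system have to satisfy at the state `s`. -/
def ResidualBound (s : State n m) (rd : Fin n → ℝ) (rp : Fin m → ℝ) (rμ : Fin n → ℝ) : Prop :=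
  rμ = 0 ∧
  pairNorm rp rd ≤ I.par.σmin / (4 * I.mu0) * I.par.CN * s.pt.mu ∧
  semiNorm I.P rp rd ≤ I.par.σmin / (4 * I.mu0) * I.par.γA * I.par.ρ * s.pt.mu

/-- `d` is a search direction that the algorithm may use at the state `s`. -/
def IsDirection (s : State n m) (d : Triple n m) : Prop :=
  ∃ (σ : ℝ) (rd : Fin n → ℝ) (rp : Fin m → ℝ) (rμ : Fin n → ℝ),
    I.par.σmin ≤ σ ∧ σ ≤ I.par.σmax ∧ I.Newton s σ d rd rp rμ ∧ I.ResidualBound s rd rp rμ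

/-- The stepsizes among which the algorithm takes the largest. -/
def admissible (s : State n m) (d : Triple n m) : Set ℝ :=
  {α | 0 < α ∧ α ≤ 1 ∧ (s.pt.move α d).mu ≤ (1 - 0.01 * α) * s.pt.mu ∧
    s.pt.move α d ∈ I.nbhd (s.pt.move α d).mu s.ζ s.lam}

/-- The test for updating the estimates at the new iterate `w`. The residuals carry the signs of
the two equations that define the seminorm and the neighborhood. -/
def UpdateTest (w : Triple n m) : Prop :=
  let rp : Fin m → ℝ := I.P.A *ᵥ w.x - I.P.b - (w.mu / I.mu0) • I.bbar
  let rd : Fin n → ℝ :=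
    -(I.P.Q *ᵥ w.x) + I.P.Aᵀ *ᵥ w.y + w.z - I.P.c - (w.mu / I.mu0) • I.cbar
  pairNorm rp rd ≤ I.par.CN * (w.mu / I.mu0) ∧
  semiNorm I.P rp rd ≤ I.par.γA * I.par.ρ * (w.mu / I.mu0)

/-- One iteration of inexact IP-PMM leads from `s` to `s'`. -/
def Step (s s' : State n m) : Prop :=
  ∃ (d : Triple n m) (α : ℝ), I.IsDirection s d ∧ IsGreatest (I.admissible s d) α ∧
    s'.pt = s.pt.move α d ∧
    (I.UpdateTest s'.pt → s'.ζ = s'.pt.x ∧ s'.lam = s'.pt.y) ∧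
    (¬ I.UpdateTest s'.pt → s'.ζ = s.ζ ∧ s'.lam = s.lam)

/-- `s 0, …, s N` are produced by `N` iterations of inexact IP-PMM. A run that stops early, or does
not stop at all, is covered through its initial segments. -/
def Run (N : ℕ) (s : ℕ → State n m) : Prop :=
  s 0 = ⟨I.start, I.start.x, I.start.y⟩ ∧ ∀ k < N, I.Step (s k) (s (k + 1))

end Instance

/-- The number `n⁴ / (0.01 κ) · ((1 + ω) log (1/ε) + log C)`. -/
noncomputable def iterationBound (κ C ω : ℝ) (n : ℕ) (ε : ℝ) : ℝ :=
  (n : ℝ) ^ 4 / (0.01 * κ) * ((1 + ω) * Real.log (1 / ε) + Real.log C)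

end IPPMM

/-! Everything rests on one uniform fact, `exists_stepsize`: all steps of length at most κ/n⁴ are
admissible. The step taken is then at least κ/n⁴, so each iteration multiplies μ by at most 1 -
0.01κ/n⁴ ≤ exp(-0.01κ/n⁴), and μ₀ ≤ C/ε^ω gives the iteration count.

Iterates are O(n). A neighborhood point is compared with θ(x̃,ỹ,z̃) + (1-θ)(x*,y*,z*), θ = μ/μ₀. The
tilde point solves the perturbed equations at level μ₀ with x̃, z̃ bounded away from 0, which is
what the seminorm condition with γ_A < 1 provides; the starred point is optimal, hence complementary
by strong duality. Monotonicity of the KKT operator gives `Bounded.fundamental_estimate`. At the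
point where ζ and λ were last set, its proximal terms vanish, so ζ, λ = O(n)
(`exists_anchor_bound`). At the current iterate, completing squares in those terms gives x - ζ, y -
λ = O(n), and the dual equation then bounds z (`exists_iterate_bound`).

Directions. The linear blocks of the Newton system therefore have right-hand sides O(nμ). A shift
(sx, sz) of that size removes them and leaves (Δx - sx)·(Δz - sz) ≥ 0. With the complementarity row,
the scaled squared norm of (Δx, Δz) is at most a multiple of nμ + (‖z‖²‖sx‖² + ‖x‖²‖sz‖²)/μ =
O(n⁴μ). This is the source of the exponent 4 (`exists_direction_bound`).

Step length. To first order in α, every admissibility condition holds with slack proportional to αμ: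
σ ≤ 1/2 serves the decrease of μ, σ ≥ σmin serves centrality and the residuals, whose inexactness
uses only a quarter of the slack. The remaining errors are O(α²n⁴μ), so a small αn⁴ suffices. -/

namespace IPPMM

/-- The Euclidean norm of a coordinate vector. -/
noncomputable def l2 {p : ℕ} (u : Fin p → ℝ) : ℝ := Real.sqrt (u ⬝ᵥ u)

/-! ### Euclidean norms of coordinate vectors and of pairs. -/

section l2

variable {p q : ℕ}

lemma l2_eq_norm (u : Fin p → ℝ) : l2 u = ‖WithLp.toLp 2 u‖ := by
  rw [l2, EuclideanSpace.norm_eq]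
  simp [dotProduct, sq]

lemma l2_nonneg (u : Fin p → ℝ) : 0 ≤ l2 u := Real.sqrt_nonneg _

lemma dotProduct_self_nonneg' (u : Fin p → ℝ) : 0 ≤ u ⬝ᵥ u :=
  Finset.sum_nonneg fun _ _ => mul_self_nonneg _

lemma l2_sq (u : Fin p → ℝ) : l2 u ^ 2 = u ⬝ᵥ u := Real.sq_sqrt (dotProduct_self_nonneg' u)

lemma l2_add_le (u v : Fin p → ℝ) : l2 (u + v) ≤ l2 u + l2 v := by
  simp only [l2_eq_norm, WithLp.toLp_add]
  exact norm_add_le _ _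

lemma l2_smul (a : ℝ) (u : Fin p → ℝ) : l2 (a • u) = |a| * l2 u := by
  simp only [l2_eq_norm, WithLp.toLp_smul, norm_smul, Real.norm_eq_abs]

lemma l2_neg (u : Fin p → ℝ) : l2 (-u) = l2 u := by
  simp only [l2_eq_norm, WithLp.toLp_neg, norm_neg]

lemma l2_sub_le (u v : Fin p → ℝ) : l2 (u - v) ≤ l2 u + l2 v := by
  simp only [l2_eq_norm, WithLp.toLp_sub]
  exact norm_sub_le _ _

lemma abs_dotProduct_le (u v : Fin p → ℝ) : |u ⬝ᵥ v| ≤ l2 u * l2 v := by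
  have h := abs_real_inner_le_norm (WithLp.toLp 2 v) (WithLp.toLp 2 u)
  rw [EuclideanSpace.inner_toLp_toLp] at h
  simp only [l2_eq_norm]
  simpa [mul_comm] using h

lemma abs_apply_le_l2 (u : Fin p → ℝ) (i : Fin p) : |u i| ≤ l2 u := by
  rw [l2_eq_norm]
  exact PiLp.norm_apply_le (WithLp.toLp 2 u) i

lemma l2_le_sqrt_mul {K : ℝ} (u : Fin p → ℝ) (hK : 0 ≤ K) (h : ∀ i, |u i| ≤ K) :
    l2 u ≤ √p * K := by
  rw [l2]
  refine Real.sqrt_le_iff.2 ⟨by positivity, ?_⟩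
  rw [mul_pow, Real.sq_sqrt (by positivity)]
  calc u ⬝ᵥ u ≤ ∑ _i : Fin p, K ^ 2 := Finset.sum_le_sum fun i _ => by
        rw [← sq, ← sq_abs]; gcongr; exact h i
    _ = p * K ^ 2 := by simp

lemma sqrt_natCast_le_of_le {m n : ℕ} (h : m ≤ n) : √(m : ℝ) ≤ n := by
  rw [Real.sqrt_le_iff]
  refine ⟨by positivity, ?_⟩
  have : (m : ℝ) ≤ n := by exact_mod_cast h
  rcases Nat.eq_zero_or_pos n with rfl | hn
  · simpa using this
  · have : (1 : ℝ) ≤ n := by exact_mod_cast hn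
    nlinarith

/-- Coarsens √p to n, so that data, reference points and iterates are all measured by multiples of
n. -/
lemma l2_le_mul {K : ℝ} {n : ℕ} (u : Fin p → ℝ) (hp : p ≤ n) (hK : 0 ≤ K) (h : ∀ i, |u i| ≤ K) :
    l2 u ≤ K * n :=
  (l2_le_sqrt_mul u hK h).trans (by
    rw [mul_comm]; gcongr; exact sqrt_natCast_le_of_le hp)

lemma l2_le_sum (u : Fin p → ℝ) (h : ∀ i, 0 ≤ u i) : l2 u ≤ ∑ i, u i := by
  rw [l2, Real.sqrt_le_iff]
  refine ⟨Finset.sum_nonneg fun i _ => h i, ?_⟩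
  rw [sq, dotProduct, Finset.sum_mul_sum]
  refine Finset.sum_le_sum fun i _ => ?_
  exact Finset.single_le_sum (f := fun j => u i * u j)
    (fun j _ => mul_nonneg (h i) (h j)) (Finset.mem_univ i)

lemma l2_le_l2_of_abs_le {K : ℝ} (u v : Fin p → ℝ) (hK : 0 ≤ K) (h : ∀ i, |u i| ≤ K * |v i|) :
    l2 u ≤ K * l2 v := by
  have h1 : l2 u ^ 2 ≤ (K * l2 v) ^ 2 := by
    rw [mul_pow, l2_sq, l2_sq, dotProduct, dotProduct, Finset.mul_sum]
    refine Finset.sum_le_sum fun i _ => ?_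
    have := mul_self_le_mul_self (abs_nonneg _) (h i)
    rw [abs_mul_abs_self] at this
    calc _ ≤ _ := this
      _ = K ^ 2 * (|v i| * |v i|) := by ring
      _ = _ := by rw [abs_mul_abs_self]
  exact le_of_sq_le_sq h1 (mul_nonneg hK (l2_nonneg v))

lemma pairNorm_eq_norm (u : Fin p → ℝ) (v : Fin q → ℝ) :
    pairNorm u v = ‖WithLp.toLp 2 (Sum.elim u v)‖ := by
  rw [pairNorm, EuclideanSpace.norm_eq]
  simp [dotProduct, sq]

lemma pairNorm_nonneg (u : Fin p → ℝ) (v : Fin q → ℝ) : 0 ≤ pairNorm u v := Real.sqrt_nonneg _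

lemma pairNorm_add_le (u u' : Fin p → ℝ) (v v' : Fin q → ℝ) :
    pairNorm (u + u') (v + v') ≤ pairNorm u v + pairNorm u' v' := by
  have : Sum.elim (u + u') (v + v') = Sum.elim u v + Sum.elim u' v' := by
    ext (i | i) <;> rfl
  simp only [pairNorm_eq_norm, this, WithLp.toLp_add]
  exact norm_add_le _ _

lemma pairNorm_smul (a : ℝ) (u : Fin p → ℝ) (v : Fin q → ℝ) :
    pairNorm (a • u) (a • v) = |a| * pairNorm u v := by
  have : Sum.elim (a • u) (a • v) = a • Sum.elim u v := by
    ext (i | i) <;> rfl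
  simp only [pairNorm_eq_norm, this, WithLp.toLp_smul, norm_smul, Real.norm_eq_abs]

lemma pairNorm_le (u : Fin p → ℝ) (v : Fin q → ℝ) : pairNorm u v ≤ l2 u + l2 v := by
  rw [pairNorm, Real.sqrt_le_iff, ← l2_sq, ← l2_sq]
  have := l2_nonneg u
  have := l2_nonneg v
  exact ⟨by positivity, by nlinarith⟩

lemma l2_le_pairNorm_left (u : Fin p → ℝ) (v : Fin q → ℝ) : l2 u ≤ pairNorm u v :=
  Real.sqrt_le_sqrt (le_add_of_nonneg_right (dotProduct_self_nonneg' v))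

lemma l2_le_pairNorm_right (u : Fin p → ℝ) (v : Fin q → ℝ) : l2 v ≤ pairNorm u v :=
  Real.sqrt_le_sqrt (le_add_of_nonneg_left (dotProduct_self_nonneg' u))

end l2

/-! ### Operator bounds from singular values. -/

section SingularValues

variable {E F : Type*} [NormedAddCommGroup E] [InnerProductSpace ℝ E] [FiniteDimensional ℝ E]
  [NormedAddCommGroup F] [InnerProductSpace ℝ F] [FiniteDimensional ℝ F] (T : E →ₗ[ℝ] F)

/-- In the eigenbasis of `T†T`, the squared norm of `T x` is a weighted sum of squares. -/
lemma norm_sq_apply_eq_sum_singularValues (x : E) :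
    ‖T x‖ ^ 2 = ∑ i : Fin (Module.finrank ℝ E), T.singularValues i ^ 2 *
      (T.isSymmetric_adjoint_comp_self.eigenvectorBasis rfl).repr x i ^ 2 := by
  set hT := T.isSymmetric_adjoint_comp_self
  set e := hT.eigenvectorBasis rfl
  have h1 : ‖T x‖ ^ 2 = inner ℝ x ((LinearMap.adjoint T ∘ₗ T) x) := by
    rw [LinearMap.comp_apply, LinearMap.adjoint_inner_right, real_inner_self_eq_norm_sq]
  rw [h1, ← e.repr.inner_map_map, PiLp.inner_apply]
  refine Finset.sum_congr rfl fun i _ => ?_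
  rw [hT.eigenvectorBasis_apply_self_apply rfl x i, T.sq_singularValues_fin rfl]
  simp only [RCLike.inner_apply, conj_trivial, RCLike.ofReal_real_eq_id, id]
  ring

lemma norm_apply_le_of_singularValues_le {C : ℝ} (hC : 0 ≤ C)
    (h : ∀ i < Module.finrank ℝ T.range, T.singularValues i ≤ C) (x : E) : ‖T x‖ ≤ C * ‖x‖ := by
  set e := T.isSymmetric_adjoint_comp_self.eigenvectorBasis rfl
  refine le_of_sq_le_sq ?_ (by positivity)
  rw [norm_sq_apply_eq_sum_singularValues, mul_pow, ← e.repr.norm_map x, EuclideanSpace.norm_sq_eq,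
    Finset.mul_sum]
  refine Finset.sum_le_sum fun i _ => ?_
  rw [Real.norm_eq_abs, sq_abs]
  gcongr
  · exact T.singularValues_nonneg _
  · by_cases hi : (i : ℕ) < Module.finrank ℝ T.range
    · exact h i hi
    · rw [T.singularValues_eq_zero_iff_le_finrank_range.2 (not_lt.1 hi)]
      exact hC

/-- Singular values beyond the rank vanish, so deleting the corresponding eigenbasis coordinates of
`x` leaves `T x` unchanged; on the remaining coordinates `T` expands by at least `C`. -/
lemma exists_preimage_norm_le_of_le_singularValues {C : ℝ} (hC : 0 < C)
    (h : ∀ i < Module.finrank ℝ T.range, C ≤ T.singularValues i) (x : E) :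
    ∃ x', T x' = T x ∧ C * ‖x'‖ ≤ ‖T x‖ := by
  set e := T.isSymmetric_adjoint_comp_self.eigenvectorBasis rfl with he
  set r := Module.finrank ℝ T.range
  let x' : E := e.repr.symm (WithLp.toLp 2 fun i => if (i : ℕ) < r then e.repr x i else 0)
  have hx' : ∀ i, e.repr x' i = if (i : ℕ) < r then e.repr x i else 0 := by simp [x']
  have hTx : T x' = T x := by
    rw [← sub_eq_zero, ← map_sub, ← norm_eq_zero, ← sq_eq_zero_iff,
      norm_sq_apply_eq_sum_singularValues]
    refine Finset.sum_eq_zero fun i _ => ?_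
    by_cases hi : (i : ℕ) < r
    · have : e.repr (x' - x) i = 0 := by
        rw [map_sub, PiLp.sub_apply, hx', if_pos hi, sub_self]
      rw [← he, this]; simp
    · rw [T.singularValues_eq_zero_iff_le_finrank_range.2 (not_lt.1 hi)]; simp
  refine ⟨x', hTx, le_of_sq_le_sq ?_ (by positivity)⟩
  rw [← hTx, norm_sq_apply_eq_sum_singularValues, mul_pow, ← e.repr.norm_map x',
    EuclideanSpace.norm_sq_eq, Finset.mul_sum]
  refine Finset.sum_le_sum fun i _ => ?_
  rw [Real.norm_eq_abs, sq_abs]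
  by_cases hi : (i : ℕ) < r
  · gcongr
    exact h i hi
  · rw [hx', if_neg hi]; simp

end SingularValues

/-! ### Farkas lemma, KKT multipliers and strong duality. -/

/-- **Farkas lemma** for finitely many linear functionals on a real vector space. -/
lemma farkas {E ι : Type*} [AddCommGroup E] [Module ℝ E] (s : Finset ι) (f : ι → E →ₗ[ℝ] ℝ)
    (g : E →ₗ[ℝ] ℝ) (h : ∀ x, (∀ i ∈ s, 0 ≤ f i x) → 0 ≤ g x) :
    ∃ c : ι → ℝ, (∀ i, 0 ≤ c i) ∧ g = ∑ i ∈ s, c i • f i := by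
  classical
  induction s using Finset.induction_on generalizing f g with
  | empty =>
    refine ⟨0, fun _ => le_rfl, LinearMap.ext fun x => ?_⟩
    have h1 := h x (by simp)
    have h2 := h (-x) (by simp)
    rw [map_neg] at h2
    simp only [Finset.sum_empty, LinearMap.zero_apply]
    linarith
  | insert a s ha ih =>
    by_cases hs : ∀ x, (∀ i ∈ s, 0 ≤ f i x) → 0 ≤ g x
    · obtain ⟨c, hc, hg⟩ := ih f g hs
      refine ⟨fun i => if i = a then 0 else c i, fun i => ?_, ?_⟩
      · dsimp only; split_ifs
        · exact le_rfl
        · exact hc i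
      · rw [Finset.sum_insert ha, hg]
        simp only [if_true, zero_smul, zero_add]
        refine Finset.sum_congr rfl fun i hi => ?_
        rw [if_neg (ne_of_mem_of_not_mem hi ha)]
    · push Not at hs
      obtain ⟨x₁, hx₁, hgx₁⟩ := hs
      have hax₁ : f a x₁ < 0 := by
        by_contra hcon
        refine absurd (h x₁ fun i hi => ?_) (not_le.2 hgx₁)
        rcases Finset.mem_insert.1 hi with rfl | hi
        · exact not_lt.1 hcon
        · exact hx₁ i hi
      -- With `f a x₀ = -1`, the map `x ↦ x + f a x • x₀` projects onto the kernel of `f a`. The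
      -- induction hypothesis is applied to the functionals composed with this projection; expanding
      -- its conclusion leaves the multiplier of `f a`, which is nonnegative because `g x₀ < 0 ≤ f i
      -- x₀`.
      set x₀ : E := (-(f a x₁))⁻¹ • x₁ with hx₀
      have hpos : 0 < (-(f a x₁))⁻¹ := inv_pos.2 (by linarith)
      have hax : f a x₀ = -1 := by
        rw [hx₀, map_smul, smul_eq_mul, inv_neg, neg_mul, inv_mul_cancel₀ hax₁.ne]
      have hfx : ∀ i ∈ s, 0 ≤ f i x₀ := fun i hi => by
        rw [hx₀, map_smul]; exact mul_nonneg hpos.le (hx₁ i hi)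
      have hgx : g x₀ < 0 := by
        rw [hx₀, map_smul]; exact mul_neg_of_pos_of_neg hpos hgx₁
      obtain ⟨c, hc, hg⟩ := ih (fun i => f i + (f i x₀) • f a) (g + (g x₀) • f a) (by
        intro x hx
        have := h (x + f a x • x₀) (fun i hi => by
          rcases Finset.mem_insert.1 hi with rfl | hi
          · simp [hax]
          · have := hx i hi
            simp only [LinearMap.add_apply, LinearMap.smul_apply, smul_eq_mul] at this
            simp only [map_add, map_smul, smul_eq_mul]
            linarith)
        simp only [map_add, map_smul, smul_eq_mul] at this
        simp only [LinearMap.add_apply, LinearMap.smul_apply, smul_eq_mul]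
        linarith)
      have hS : 0 ≤ ∑ i ∈ s, c i * f i x₀ :=
        Finset.sum_nonneg fun i hi => mul_nonneg (hc i) (hfx i hi)
      refine ⟨fun i => if i = a then (∑ i ∈ s, c i * f i x₀) - g x₀ else c i, fun i => ?_, ?_⟩
      · dsimp only; split_ifs
        · linarith
        · exact hc i
      · rw [Finset.sum_insert ha]
        simp only [if_true]
        rw [Finset.sum_congr rfl (g := fun i => c i • f i)
          fun i hi => by rw [if_neg (ne_of_mem_of_not_mem hi ha)]]
        refine LinearMap.ext fun x => ?_
        have := congrArg (fun l => l x) hg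
        simp only [LinearMap.add_apply, LinearMap.smul_apply, LinearMap.sum_apply, smul_eq_mul,
          mul_add, Finset.sum_add_distrib] at this ⊢
        have e : ∑ i ∈ s, c i * (f i x₀ * f a x) = (∑ i ∈ s, c i * f i x₀) * f a x := by
          rw [Finset.sum_mul]; exact Finset.sum_congr rfl fun i _ => by ring
        rw [e] at this
        linarith

namespace QP

variable {n m : ℕ} {P : QP n m}

lemma SeparableConvex.exists_diagonal (h : P.SeparableConvex) :
    ∃ d : Fin n → ℝ, P.Q = diagonal d ∧ ∀ i, 0 ≤ d i :=
  ⟨P.Q.diag, h.1.diagonal_diag.symm, fun _ => h.2.diag_nonneg⟩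

lemma dotProduct_diagonal_mulVec (d x y : Fin n → ℝ) :
    x ⬝ᵥ diagonal d *ᵥ y = ∑ i, d i * (x i * y i) := by
  rw [dotProduct]
  exact Finset.sum_congr rfl fun i _ => by rw [mulVec_diagonal]; ring

lemma SeparableConvex.dotProduct_comm (h : P.SeparableConvex) (x y : Fin n → ℝ) :
    x ⬝ᵥ P.Q *ᵥ y = y ⬝ᵥ P.Q *ᵥ x := by
  obtain ⟨d, hd, -⟩ := h.exists_diagonal
  rw [hd, dotProduct_diagonal_mulVec, dotProduct_diagonal_mulVec]
  exact Finset.sum_congr rfl fun i _ => by ring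

lemma SeparableConvex.dotProduct_nonneg (h : P.SeparableConvex) (x : Fin n → ℝ) :
    0 ≤ x ⬝ᵥ P.Q *ᵥ x := by
  obtain ⟨d, hd, hd0⟩ := h.exists_diagonal
  rw [hd, dotProduct_diagonal_mulVec]
  exact Finset.sum_nonneg fun i _ => mul_nonneg (hd0 i) (mul_self_nonneg _)

/-- First-order optimality: the gradient is nonnegative along feasible directions. -/
lemma gradient_nonneg (hQ : P.SeparableConvex) {x : Fin n → ℝ} (hx : P.PrimalFeasible x)
    (hopt : ∀ x', P.PrimalFeasible x' → P.primalObj x ≤ P.primalObj x') {d : Fin n → ℝ}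
    (hA : P.A *ᵥ d = 0) (hd : ∀ i, x i = 0 → 0 ≤ d i) : 0 ≤ (P.Q *ᵥ x + P.c) ⬝ᵥ d := by
  -- Only the active coordinates constrain `d`; the others stay positive for small `t`. Dividing the
  -- change of the objective by `t` and letting `t → 0+` then leaves the gradient term.
  have hfeas : ∀ᶠ t in 𝓝[>] (0 : ℝ), P.PrimalFeasible (x + t • d) := by
    have : ∀ᶠ t in 𝓝[>] (0 : ℝ), ∀ i, 0 ≤ x i + t * d i := by
      rw [eventually_all]
      intro i
      rcases (hx.2 i).eq_or_lt' with h0 | hpos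
      · filter_upwards [self_mem_nhdsWithin] with t ht
        rw [h0]
        simpa using mul_nonneg (le_of_lt ht) (hd i h0)
      · have hc : Tendsto (fun t : ℝ => x i + t * d i) (𝓝[>] 0) (𝓝 (x i + 0 * d i)) :=
          (Continuous.tendsto (by fun_prop) 0).mono_left nhdsWithin_le_nhds
        rw [zero_mul, add_zero] at hc
        exact (hc.eventually (lt_mem_nhds hpos)).mono fun _ h => h.le
    filter_upwards [this] with t ht
    exact ⟨by rw [mulVec_add, mulVec_smul, hA, smul_zero, add_zero, hx.1], fun i => ht i⟩
  have hineq : ∀ᶠ t in 𝓝[>] (0 : ℝ), 0 ≤ (P.Q *ᵥ x + P.c) ⬝ᵥ d + t * (1 / 2 * (d ⬝ᵥ P.Q *ᵥ d)) := by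
    filter_upwards [hfeas, self_mem_nhdsWithin] with t ht htpos
    have h := hopt _ ht
    have hexp : P.primalObj (x + t • d) - P.primalObj x =
        t * ((P.Q *ᵥ x + P.c) ⬝ᵥ d + t * (1 / 2 * (d ⬝ᵥ P.Q *ᵥ d))) := by
      simp only [primalObj, mulVec_add, mulVec_smul, dotProduct_add, add_dotProduct,
        smul_dotProduct, dotProduct_smul, smul_eq_mul]
      rw [hQ.dotProduct_comm x d, _root_.dotProduct_comm (P.Q *ᵥ x) d]
      ring
    have : 0 ≤ t * ((P.Q *ᵥ x + P.c) ⬝ᵥ d + t * (1 / 2 * (d ⬝ᵥ P.Q *ᵥ d))) := by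
      rw [← hexp]; linarith
    exact nonneg_of_mul_nonneg_right this htpos
  have hlim : Tendsto (fun t : ℝ => (P.Q *ᵥ x + P.c) ⬝ᵥ d + t * (1 / 2 * (d ⬝ᵥ P.Q *ᵥ d)))
      (𝓝[>] 0) (𝓝 ((P.Q *ᵥ x + P.c) ⬝ᵥ d + 0 * (1 / 2 * (d ⬝ᵥ P.Q *ᵥ d)))) :=
    (Continuous.tendsto (by fun_prop) 0).mono_left nhdsWithin_le_nhds
  rw [zero_mul, add_zero] at hlim
  exact ge_of_tendsto hlim hineq

/-- Karush-Kuhn-Tucker multipliers exist at a primal optimal solution. -/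
lemma exists_kkt (hQ : P.SeparableConvex) {x : Fin n → ℝ} (hx : P.PrimalFeasible x)
    (hopt : ∀ x', P.PrimalFeasible x' → P.primalObj x ≤ P.primalObj x') :
    ∃ (y : Fin m → ℝ) (z : Fin n → ℝ), P.DualFeasible x y z ∧ x ⬝ᵥ z = 0 := by
  classical
  let row : Fin m → (Fin n → ℝ) →ₗ[ℝ] ℝ := fun j => LinearMap.proj j ∘ₗ P.A.mulVecLin
  -- The equation `A d = 0` enters as two opposite inequalities, whose multipliers are subtracted to
  -- form `y`. Inactive coordinates contribute the zero functional, so `z` can be set to 0 there,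
  -- which is complementarity.
  let f : (Fin m ⊕ Fin m) ⊕ Fin n → (Fin n → ℝ) →ₗ[ℝ] ℝ :=
    Sum.elim (Sum.elim row fun j => -row j) fun i => if x i = 0 then LinearMap.proj i else 0
  let g : (Fin n → ℝ) →ₗ[ℝ] ℝ := dotProductBilin ℝ ℝ (P.Q *ᵥ x + P.c)
  have hg : ∀ d, g d = (P.Q *ᵥ x + P.c) ⬝ᵥ d := fun _ => rfl
  have hrow : ∀ j d, row j d = (P.A *ᵥ d) j := fun _ _ => rfl
  obtain ⟨c, hc, hgc⟩ := farkas Finset.univ f g (by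
    intro d hd
    rw [hg]
    refine gradient_nonneg hQ hx hopt (funext fun j => ?_) fun i hi => ?_
    · have h1 := hd (.inl (.inl j)) (Finset.mem_univ _)
      have h2 := hd (.inl (.inr j)) (Finset.mem_univ _)
      simp only [f, Sum.elim_inl, Sum.elim_inr, LinearMap.neg_apply, hrow] at h1 h2
      simp only [Pi.zero_apply]
      linarith
    · have := hd (.inr i) (Finset.mem_univ _)
      simpa [f, hi] using this)
  let y : Fin m → ℝ := fun j => c (.inl (.inl j)) - c (.inl (.inr j))
  let z : Fin n → ℝ := fun i => if x i = 0 then c (.inr i) else 0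
  refine ⟨y, z, ⟨funext fun i => ?_, fun i => ?_⟩, ?_⟩
  · have := congrArg (fun l => l (Pi.single i 1)) hgc
    simp only [hg, dotProduct_single_one, Fintype.sum_sum_type, LinearMap.add_apply,
      LinearMap.sum_apply, LinearMap.smul_apply, smul_eq_mul, f, Sum.elim_inl, Sum.elim_inr,
      LinearMap.neg_apply, hrow, mulVec_single_one, col_apply] at this
    rw [this]
    have h3 : ∑ k, c (.inr k) * (if x k = 0 then (LinearMap.proj k : (Fin n → ℝ) →ₗ[ℝ] ℝ) else 0)
        (Pi.single i 1) = z i := by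
      rw [Finset.sum_eq_single i]
      · by_cases h : x i = 0 <;> simp [z, h]
      · intro k _ hk
        by_cases h : x k = 0 <;> simp [h, Pi.single_eq_of_ne hk]
      · simp
    rw [h3, Pi.add_apply, mulVec, dotProduct, ← Finset.sum_add_distrib]
    congr 1
    refine Finset.sum_congr rfl fun j _ => ?_
    simp only [transpose_apply, y]
    ring
  · simp only [z, Pi.zero_apply]; split_ifs
    · exact hc _
    · exact le_rfl
  · refine Finset.sum_eq_zero fun i _ => ?_
    by_cases h : x i = 0 <;> simp [z, h]

/-- Strong duality: optimal solutions of the pair are complementary. -/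
lemma IsOptimal.complementary (hQ : P.SeparableConvex) {x : Fin n → ℝ} {y : Fin m → ℝ}
    {z : Fin n → ℝ} (h : P.IsOptimal x y z) : x ⬝ᵥ z = 0 := by
  obtain ⟨⟨hx, hopt⟩, hyz, hdopt⟩ := h
  obtain ⟨y', z', hyz', hcomp⟩ := exists_kkt hQ hx hopt
  -- With `x` fixed, the dual objective and the gap `x ⬝ᵥ z` have constant sum. Dual optimality thus
  -- minimizes the gap, and the KKT multipliers show that the minimum is 0.
  have key : ∀ y z, P.DualFeasible x y z → P.b ⬝ᵥ y + x ⬝ᵥ z = x ⬝ᵥ (P.Q *ᵥ x + P.c) := by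
    intro y z h
    rw [← h.1, dotProduct_add, mulVec_transpose, dotProduct_comm x (y ᵥ* P.A), ← dotProduct_mulVec,
      hx.1, dotProduct_comm y]
  have h1 := key y z hyz
  have h2 := key y' z' hyz'
  have h3 := hdopt x y' z' hyz'
  simp only [dualObj] at h3
  refine le_antisymm (by linarith) ?_
  exact Finset.sum_nonneg fun i _ => mul_nonneg (hx.2 i) (hyz.2 i)

end QP

/-! ### One constant for all data assumptions. -/

namespace QP

variable {n m : ℕ} {P : QP n m}

lemma SeparableConvex.l2_mulVec_le (h : P.SeparableConvex) {C : ℝ} (hC : 0 ≤ C)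
    (hs : ∀ t ∈ spectrum ℝ P.Q, t ≤ C) (x : Fin n → ℝ) : l2 (P.Q *ᵥ x) ≤ C * l2 x := by
  obtain ⟨d, hd, hd0⟩ := h.exists_diagonal
  refine l2_le_l2_of_abs_le _ _ hC fun i => ?_
  have : d i ≤ C := hs _ (by rw [hd, spectrum_diagonal]; exact ⟨i, rfl⟩)
  rw [hd, mulVec_diagonal, abs_mul, abs_of_nonneg (hd0 i)]
  gcongr

variable {Cmin Cmax CQ Cr : ℝ}

lemma finrank_range_toEuclideanLin (A : Matrix (Fin m) (Fin n) ℝ) :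
    Module.finrank ℝ (Matrix.toEuclideanLin A).range = A.rank := by
  exact (congrArg (fun f => Module.finrank ℝ (f A).range) (Matrix.toLpLin_eq_toLin 2 2)).trans
    (Matrix.rank_eq_finrank_range_toLin A _ _).symm

lemma norm_toEuclideanLin (A : Matrix (Fin m) (Fin n) ℝ) (x : Fin n → ℝ) :
    ‖Matrix.toEuclideanLin A (WithLp.toLp 2 x)‖ = l2 (A *ᵥ x) := by
  rw [l2_eq_norm, Matrix.toLpLin_toLp, Matrix.toLin'_apply]

lemma RegularData.l2_mulVec_le (h : P.RegularData Cmin Cmax CQ Cr) (hC : 0 ≤ Cmax)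
    (x : Fin n → ℝ) : l2 (P.A *ᵥ x) ≤ Cmax * l2 x := by
  rw [← norm_toEuclideanLin, l2_eq_norm]
  refine norm_apply_le_of_singularValues_le _ hC (fun i hi => (h.2.1 i ?_).2) _
  rwa [finrank_range_toEuclideanLin, h.1] at hi

lemma RegularData.exists_preimage (h : P.RegularData Cmin Cmax CQ Cr) (hC : 0 < Cmin)
    (b : Fin m → ℝ) : ∃ x, P.A *ᵥ x = b ∧ Cmin * l2 x ≤ l2 b := by
  have hsurj : Function.Surjective (Matrix.toEuclideanLin P.A) := by
    rw [← LinearMap.range_eq_top]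
    apply Submodule.eq_top_of_finrank_eq
    rw [finrank_range_toEuclideanLin, h.1, finrank_euclideanSpace_fin]
  obtain ⟨x₀, hx₀⟩ := hsurj (WithLp.toLp 2 b)
  obtain ⟨x, hx, hn⟩ := exists_preimage_norm_le_of_le_singularValues (Matrix.toEuclideanLin P.A)
    hC (fun i hi => (h.2.1 i (by rwa [finrank_range_toEuclideanLin, h.1] at hi)).1) x₀
  refine ⟨WithLp.ofLp x, ?_, ?_⟩
  · rw [hx₀] at hx
    exact congrArg WithLp.ofLp hx
  · rw [hx₀] at hn
    simpa [l2_eq_norm] using hn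

lemma RegularData.le (h : P.RegularData Cmin Cmax CQ Cr) : m ≤ n := by
  have := P.A.rank_le_width
  rwa [h.1] at this

end QP

lemma le_of_sq_le_mul {a b : ℝ} (ha : 0 ≤ a) (hb : 0 ≤ b) (h : a ^ 2 ≤ a * b) : a ≤ b := by
  rcases ha.eq_or_lt' with h0 | hpos
  · rwa [h0]
  · rw [sq] at h
    exact le_of_mul_le_mul_left h hpos

lemma l2_transpose_mulVec_le {n m : ℕ} {A : Matrix (Fin m) (Fin n) ℝ} {C : ℝ} (hC : 0 ≤ C)
    (h : ∀ x, l2 (A *ᵥ x) ≤ C * l2 x) (y : Fin m → ℝ) : l2 (Aᵀ *ᵥ y) ≤ C * l2 y := by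
  refine le_of_sq_le_mul (l2_nonneg _) (mul_nonneg hC (l2_nonneg _)) ?_
  rw [l2_sq]
  calc Aᵀ *ᵥ y ⬝ᵥ Aᵀ *ᵥ y = y ⬝ᵥ A *ᵥ (Aᵀ *ᵥ y) := by
        rw [mulVec_transpose A y, ← dotProduct_mulVec]
    _ ≤ l2 y * l2 (A *ᵥ (Aᵀ *ᵥ y)) := (le_abs_self _).trans (abs_dotProduct_le _ _)
    _ ≤ l2 y * (C * l2 (Aᵀ *ᵥ y)) := by gcongr; exacts [l2_nonneg _, h _]
    _ = _ := by ring

/-- A bounded right inverse of `A` dualizes: if `A x = y`, then `y ⬝ᵥ y = (Aᵀ y) ⬝ᵥ x`. This is how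
multipliers are recovered from the dual equation. -/
lemma l2_le_of_preimage {n m : ℕ} {A : Matrix (Fin m) (Fin n) ℝ} {K : ℝ} (hK : 0 ≤ K)
    (h : ∀ b, ∃ x, A *ᵥ x = b ∧ l2 x ≤ K * l2 b) (y : Fin m → ℝ) :
    l2 y ≤ K * l2 (Aᵀ *ᵥ y) := by
  obtain ⟨x, hx, hl⟩ := h y
  refine le_of_sq_le_mul (l2_nonneg _) (mul_nonneg hK (l2_nonneg _)) ?_
  rw [l2_sq]
  calc y ⬝ᵥ y = (Aᵀ *ᵥ y) ⬝ᵥ x := by rw [mulVec_transpose, ← dotProduct_mulVec, hx]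
    _ ≤ l2 (Aᵀ *ᵥ y) * l2 x := (le_abs_self _).trans (abs_dotProduct_le _ _)
    _ ≤ l2 (Aᵀ *ᵥ y) * (K * l2 y) := by gcongr; exact l2_nonneg _
    _ = _ := by ring

/-- Quantitative consequences of the standing assumptions, with a single constant `K`. -/
structure Instance.Bounded {n m : ℕ} (I : Instance n m) (K : ℝ) : Prop where
  pos : 0 < n
  le : m ≤ n
  one_le : 1 ≤ K
  Q_nonneg : ∀ x, 0 ≤ x ⬝ᵥ I.P.Q *ᵥ x
  Q_le : ∀ x, l2 (I.P.Q *ᵥ x) ≤ K * l2 x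
  A_le : ∀ x, l2 (I.P.A *ᵥ x) ≤ K * l2 x
  At_le : ∀ y, l2 (I.P.Aᵀ *ᵥ y) ≤ K * l2 y
  le_At : ∀ y, l2 y ≤ K * l2 (I.P.Aᵀ *ᵥ y)
  A_surj : ∀ b, ∃ x, I.P.A *ᵥ x = b ∧ l2 x ≤ K * l2 b
  b_le : l2 I.P.b ≤ K * n
  c_le : l2 I.P.c ≤ K * n
  y0_le : l2 I.y0 ≤ K * n
  opt : ∃ (x : Fin n → ℝ) (y : Fin m → ℝ) (z : Fin n → ℝ), I.P.A *ᵥ x = I.P.b ∧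
    -(I.P.Q *ᵥ x) + I.P.Aᵀ *ᵥ y + z = I.P.c ∧ (∀ i, 0 ≤ x i ∧ x i ≤ K) ∧
    (∀ i, 0 ≤ z i ∧ z i ≤ K) ∧ x ⬝ᵥ z = 0 ∧ l2 y ≤ K * n

lemma Instance.exists_bounded (par : Params) (Cy Cstar Cmin Cmax CQ Cr : ℝ) (hCy : 0 ≤ Cy)
    (hCstar : 0 ≤ Cstar) (hCmin : 0 < Cmin) (hCmax : 0 < Cmax) (hCQ : 0 < CQ) (hCr : 0 < Cr) :
    ∃ K : ℝ, ∀ (n m : ℕ) (P : QP n m) (y0 : Fin m → ℝ), 0 < n → P.SeparableConvex →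
      P.BoundedOptimalSolution Cstar → P.RegularData Cmin Cmax CQ Cr → ‖y0‖ ≤ Cy →
      (Instance.mk P par y0).Bounded K := by
  -- A sum dominates each of its nonnegative terms; `Cmin⁻¹` bounds the right inverse of `A`, and
  -- the 1 gives `1 ≤ K`.
  obtain ⟨K, hK⟩ : ∃ K, K = 1 + Cy + Cstar + Cmin⁻¹ + Cmax + CQ + Cr := ⟨_, rfl⟩
  have hi : 0 < Cmin⁻¹ := inv_pos.2 hCmin
  refine ⟨K, fun n m P y0 hn hQ hopt hreg hy0 => ?_⟩
  have hA : ∀ x, l2 (P.A *ᵥ x) ≤ K * l2 x := fun x =>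
    (hreg.l2_mulVec_le hCmax.le x).trans
      (mul_le_mul_of_nonneg_right (by linarith) (l2_nonneg _))
  have hsurj : ∀ b, ∃ x, P.A *ᵥ x = b ∧ l2 x ≤ K * l2 b := fun b => by
    obtain ⟨x, hx, hle⟩ := hreg.exists_preimage hCmin b
    refine ⟨x, hx, ?_⟩
    calc l2 x = Cmin⁻¹ * (Cmin * l2 x) := by rw [inv_mul_cancel_left₀ hCmin.ne']
      _ ≤ Cmin⁻¹ * l2 b := by gcongr
      _ ≤ K * l2 b := mul_le_mul_of_nonneg_right (by linarith) (l2_nonneg _)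
  have hnorm : ∀ {p : ℕ} (u : Fin p → ℝ) {C : ℝ}, p ≤ n → ‖u‖ ≤ C → C ≤ K → l2 u ≤ K * n :=
    fun u C hp hu hC => l2_le_mul u hp (by linarith) fun i => (norm_le_pi_norm u i).trans
      (hu.trans hC)
  exact
    { pos := hn
      le := hreg.le
      one_le := by linarith
      Q_nonneg := hQ.dotProduct_nonneg
      Q_le := fun x => (hQ.l2_mulVec_le hCQ.le hreg.2.2.1 x).trans
        (mul_le_mul_of_nonneg_right (by linarith) (l2_nonneg _))
      A_le := hA
      At_le := l2_transpose_mulVec_le (by linarith) hA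
      le_At := l2_le_of_preimage (by linarith) hsurj
      A_surj := hsurj
      b_le := hnorm _ hreg.le hreg.2.2.2.2 (by linarith)
      c_le := hnorm _ le_rfl hreg.2.2.2.1 (by linarith)
      y0_le := hnorm _ hreg.le hy0 (by linarith)
      opt := by
        obtain ⟨x, y, z, h, hx, hy, hz⟩ := hopt
        refine ⟨x, y, z, h.1.1.1, ?_, fun i => ⟨h.1.1.2 i, ?_⟩, fun i => ⟨h.2.1.2 i, ?_⟩,
          h.complementary hQ, hnorm _ hreg.le hy (by linarith)⟩
        · rw [add_assoc, h.2.1.1]; abel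
        · exact (le_abs_self _).trans ((norm_le_pi_norm x i).trans (by linarith))
        · exact (le_abs_self _).trans ((norm_le_pi_norm z i).trans (by linarith)) }

/-! ### The two measures of residuals, treated uniformly. -/

/-- A seminorm on pairs of residuals that is controlled by the Euclidean norms. -/
structure IsResidualNorm {m n : ℕ} (K : ℝ) (N : (Fin m → ℝ) → (Fin n → ℝ) → ℝ) : Prop where
  add_le : ∀ b b' c c', N (b + b') (c + c') ≤ N b c + N b' c'
  smul_le : ∀ (a : ℝ) b c, N (a • b) (a • c) ≤ |a| * N b c
  le : ∀ b c, N b c ≤ K * (l2 b + l2 c)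

lemma isResidualNorm_pairNorm {m n : ℕ} {K : ℝ} (hK : 1 ≤ K) :
    IsResidualNorm K (pairNorm : (Fin m → ℝ) → (Fin n → ℝ) → ℝ) where
  add_le _ _ _ _ := pairNorm_add_le _ _ _ _
  smul_le _ _ _ := (pairNorm_smul _ _ _).le
  le b c := (pairNorm_le b c).trans
    (le_mul_of_one_le_left (add_nonneg (l2_nonneg b) (l2_nonneg c)) hK)

section semiNorm

variable {n m : ℕ} {P : QP n m}

lemma semiNorm_le {b : Fin m → ℝ} {c : Fin n → ℝ} {x : Fin n → ℝ} {y : Fin m → ℝ} {z : Fin n → ℝ}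
    (hb : P.A *ᵥ x = b) (hc : -(P.Q *ᵥ x) + P.Aᵀ *ᵥ y + z = c) : semiNorm P b c ≤ pairNorm x z :=
  csInf_le ⟨0, by rintro t ⟨x, y, z, -, -, rfl⟩; exact pairNorm_nonneg _ _⟩
    ⟨x, y, z, hb, hc, rfl⟩

/-- Near-minimizers replace an attained minimum. Surjectivity of `A` makes the defining set
nonempty; otherwise `sInf` would be the default value 0. -/
lemma exists_of_semiNorm_lt (hA : ∀ b, ∃ x, P.A *ᵥ x = b) {b : Fin m → ℝ} {c : Fin n → ℝ} {t : ℝ}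
    (h : semiNorm P b c < t) : ∃ (x : Fin n → ℝ) (y : Fin m → ℝ) (z : Fin n → ℝ),
      P.A *ᵥ x = b ∧ -(P.Q *ᵥ x) + P.Aᵀ *ᵥ y + z = c ∧ pairNorm x z < t := by
  obtain ⟨x₀, hx₀⟩ := hA b
  obtain ⟨_, ⟨x, y, z, hb, hc, rfl⟩, hlt⟩ := exists_lt_of_csInf_lt
    (s := {t : ℝ | ∃ (x : Fin n → ℝ) (y : Fin m → ℝ) (z : Fin n → ℝ),
      P.A *ᵥ x = b ∧ -(P.Q *ᵥ x) + P.Aᵀ *ᵥ y + z = c ∧ t = pairNorm x z})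
    ⟨_, x₀, 0, c + P.Q *ᵥ x₀, hx₀, by rw [mulVec_zero]; abel, rfl⟩ h
  exact ⟨x, y, z, hb, hc, hlt⟩

lemma semiNorm_add_le (hA : ∀ b, ∃ x, P.A *ᵥ x = b) (b b' : Fin m → ℝ) (c c' : Fin n → ℝ) :
    semiNorm P (b + b') (c + c') ≤ semiNorm P b c + semiNorm P b' c' := by
  refine le_of_forall_pos_le_add fun ε hε => ?_
  obtain ⟨x, y, z, h1, h2, h3⟩ := exists_of_semiNorm_lt hA
    (lt_add_of_pos_right (semiNorm P b c) (half_pos hε))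
  obtain ⟨x', y', z', h1', h2', h3'⟩ := exists_of_semiNorm_lt hA
    (lt_add_of_pos_right (semiNorm P b' c') (half_pos hε))
  have := semiNorm_le (P := P) (b := b + b') (c := c + c') (x := x + x') (y := y + y')
    (z := z + z') (by rw [mulVec_add, h1, h1'])
    (by rw [mulVec_add, mulVec_add, ← h2, ← h2']; abel)
  linarith [pairNorm_add_le x x' z z']

lemma semiNorm_smul_le (hA : ∀ b, ∃ x, P.A *ᵥ x = b) (a : ℝ) (b : Fin m → ℝ) (c : Fin n → ℝ) :
    semiNorm P (a • b) (a • c) ≤ |a| * semiNorm P b c := by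
  refine le_of_forall_pos_le_add fun ε hε => ?_
  -- The tolerance `ε / (|a| + 1)` avoids treating `a = 0` separately.
  have ha : 0 < |a| + 1 := by positivity
  obtain ⟨x, y, z, h1, h2, h3⟩ := exists_of_semiNorm_lt hA
    (lt_add_of_pos_right (semiNorm P b c) (div_pos hε ha))
  have := semiNorm_le (P := P) (b := a • b) (c := a • c) (x := a • x) (y := a • y)
    (z := a • z) (by rw [mulVec_smul, h1])
    (by rw [mulVec_smul, mulVec_smul, ← h2, smul_add, smul_add, smul_neg])
  rw [pairNorm_smul] at this
  calc _ ≤ |a| * (semiNorm P b c + ε / (|a| + 1)) :=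
        this.trans (mul_le_mul_of_nonneg_left h3.le (abs_nonneg a))
    _ = |a| * semiNorm P b c + |a| / (|a| + 1) * ε := by ring
    _ ≤ |a| * semiNorm P b c + 1 * ε := by
        gcongr
        rw [div_le_one ha]; linarith
    _ = _ := by ring

end semiNorm

/-! ### Boundedness of the neighborhood points and of the iterates. -/

lemma mu_eq_sum {n m : ℕ} (w : Triple n m) (hn : 0 < n) : w.x ⬝ᵥ w.z = n * w.mu := by
  have : (n : ℝ) ≠ 0 := by positivity
  rw [Triple.mu]; field_simp

namespace Instance

variable {n m : ℕ} {I : Instance n m} {K : ℝ}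

lemma Bounded.one_le_n (h : I.Bounded K) : (1 : ℝ) ≤ n := by exact_mod_cast h.pos

lemma Bounded.surj (h : I.Bounded K) (b : Fin m → ℝ) : ∃ x, I.P.A *ᵥ x = b :=
  (h.A_surj b).imp fun _ hx => hx.1

/-- The candidate `(x, 0, c + Q x)` with a bounded preimage `x` of `b` already has norm of the
required size. -/
lemma Bounded.isResidualNorm_semiNorm (h : I.Bounded K) :
    IsResidualNorm (3 * K ^ 2) (semiNorm I.P) where
  add_le := semiNorm_add_le h.surj
  smul_le := semiNorm_smul_le h.surj
  le b c := by
    obtain ⟨x, hx, hl⟩ := h.A_surj b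
    have h1 := semiNorm_le (P := I.P) (b := b) (c := c) (x := x) (y := 0) (z := c + I.P.Q *ᵥ x) hx
      (by rw [mulVec_zero]; abel)
    have h2 := pairNorm_le x (c + I.P.Q *ᵥ x)
    have h3 := l2_add_le c (I.P.Q *ᵥ x)
    have h4 := h.Q_le x
    have hK := h.one_le
    have hb := l2_nonneg b
    have hc := l2_nonneg c
    have h5 : K * l2 x ≤ K * (K * l2 b) := by gcongr
    have h6 : K * l2 b ≤ K * (K * l2 b) := by
      gcongr
      exact le_mul_of_one_le_left hb hK
    have h7 : 1 * l2 c ≤ K ^ 2 * l2 c := by gcongr; nlinarith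
    have h8 : 0 ≤ K ^ 2 * l2 c := by positivity
    have h9 : 0 ≤ K ^ 2 * l2 b := by positivity
    nlinarith

/-- The initial duality measure does not depend on `n`, so divisions by it cost no power of `n`. -/
lemma mu0_eq (hn : 0 < n) : I.mu0 = I.par.ρ ^ 2 := by
  have h := mu_eq_sum I.start hn
  have : (n : ℝ) ≠ 0 := by positivity
  simp only [start, dotProduct, Finset.sum_const, Finset.card_univ, Fintype.card_fin,
    nsmul_eq_mul] at h
  have := mul_left_cancel₀ this h
  rw [mu0, sq]
  exact this.symm

lemma mu_pos_of_pos {w : Triple n m} (hn : 0 < n) (h : ∀ i, 0 < w.x i ∧ 0 < w.z i) :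
    0 < w.mu := by
  have : Nonempty (Fin n) := ⟨⟨0, hn⟩⟩
  exact div_pos (Finset.sum_pos (fun i _ => mul_pos (h i).1 (h i).2) Finset.univ_nonempty)
    (by positivity)

lemma Bounded.l2_bbar_le (h : I.Bounded K) (hρ : 0 < I.par.ρ) :
    l2 I.bbar ≤ (K * I.par.ρ + K) * n := by
  have h1 : l2 I.start.x ≤ I.par.ρ * n :=
    l2_le_mul _ le_rfl hρ.le fun i => (abs_of_pos hρ).le
  have hK := h.one_le
  calc l2 I.bbar ≤ l2 (I.P.A *ᵥ I.start.x) + l2 I.P.b := l2_sub_le _ _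
    _ ≤ K * (I.par.ρ * n) + K * n := by
      gcongr
      · exact (h.A_le _).trans (by gcongr)
      · exact h.b_le
    _ = _ := by ring

lemma Bounded.l2_cbar_le (h : I.Bounded K) (hρ : 0 < I.par.ρ) :
    l2 I.cbar ≤ (K * I.par.ρ + K ^ 2 + I.par.ρ + K) * n := by
  have h1 : l2 I.start.x ≤ I.par.ρ * n :=
    l2_le_mul _ le_rfl hρ.le fun i => (abs_of_pos hρ).le
  have h2 : l2 I.start.z ≤ I.par.ρ * n :=
    l2_le_mul _ le_rfl hρ.le fun i => (abs_of_pos hρ).le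
  have hK := h.one_le
  calc l2 I.cbar ≤ l2 (I.P.Q *ᵥ I.start.x) + l2 (I.P.Aᵀ *ᵥ I.start.y) + l2 I.start.z
        + l2 I.P.c := by
        refine (l2_sub_le _ _).trans ?_
        gcongr
        refine (l2_add_le _ _).trans ?_
        gcongr
        refine (l2_add_le _ _).trans ?_
        rw [l2_neg]
    _ ≤ K * (I.par.ρ * n) + K * (K * n) + I.par.ρ * n + K * n := by
      gcongr
      · exact (h.Q_le _).trans (by gcongr)
      · exact (h.At_le _).trans (by gcongr; exact h.y0_le)
      · exact h.c_le
    _ = _ := by ring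

/-- Perturbations that are small in the seminorm can be absorbed by a positive shift of the
starting point. -/
lemma Bounded.exists_reference (h : I.Bounded K) (hpar : I.par.Valid) {bt : Fin m → ℝ}
    {ct : Fin n → ℝ} (h1 : pairNorm bt ct ≤ I.par.CN)
    (h2 : semiNorm I.P bt ct ≤ I.par.γA * I.par.ρ) :
    ∃ (x : Fin n → ℝ) (y : Fin m → ℝ) (z : Fin n → ℝ), I.P.A *ᵥ x = I.P.b + (I.bbar + bt) ∧
      -(I.P.Q *ᵥ x) + I.P.Aᵀ *ᵥ y + z = I.P.c + (I.cbar + ct) ∧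
      (∀ i, (1 - I.par.γA) / 2 * I.par.ρ ≤ x i ∧ x i ≤ 2 * I.par.ρ) ∧
      (∀ i, (1 - I.par.γA) / 2 * I.par.ρ ≤ z i ∧ z i ≤ 2 * I.par.ρ) ∧
      l2 y ≤ (K + K * (I.par.CN + K * I.par.ρ + I.par.ρ)) * n := by
  obtain ⟨-, hCN, ⟨hγ0, hγ1⟩, -, hρ⟩ := hpar
  have hK := h.one_le
  have hn := h.one_le_n
  -- The midpoint between `γA ρ` and `ρ` leaves room for a near-minimizer and still keeps the
  -- shifted start at least `(1 - γA) / 2 * ρ` in every entry.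
  have hlt : semiNorm I.P bt ct < (1 + I.par.γA) / 2 * I.par.ρ :=
    h2.trans_lt (mul_lt_mul_of_pos_right (by linarith) hρ)
  have hle : (1 + I.par.γA) / 2 * I.par.ρ ≤ I.par.ρ := by nlinarith
  obtain ⟨x, y, z, hb, hc, hxz⟩ := exists_of_semiNorm_lt h.surj hlt
  have hx : ∀ i, |x i| ≤ (1 + I.par.γA) / 2 * I.par.ρ := fun i =>
    (abs_apply_le_l2 x i).trans ((l2_le_pairNorm_left x z).trans hxz.le)
  have hz : ∀ i, |z i| ≤ (1 + I.par.γA) / 2 * I.par.ρ := fun i =>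
    (abs_apply_le_l2 z i).trans ((l2_le_pairNorm_right x z).trans hxz.le)
  have hbd : ∀ t : ℝ, |t| ≤ (1 + I.par.γA) / 2 * I.par.ρ →
      (1 - I.par.γA) / 2 * I.par.ρ ≤ I.par.ρ + t ∧ I.par.ρ + t ≤ 2 * I.par.ρ := fun t ht => by
    have := abs_le.1 ht
    constructor <;> linarith
  refine ⟨I.start.x + x, I.start.y + y, I.start.z + z, ?_, ?_, fun i => hbd _ (hx i),
    fun i => hbd _ (hz i), ?_⟩
  · rw [mulVec_add, hb, bbar]; abel
  · rw [mulVec_add, mulVec_add, ← hc, cbar]; abel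
  · have hy : l2 y ≤ K * (I.par.CN + K * I.par.ρ + I.par.ρ) := by
      refine (h.le_At y).trans ?_
      gcongr
      have : I.P.Aᵀ *ᵥ y = ct + I.P.Q *ᵥ x - z := by rw [← hc]; abel
      rw [this]
      refine (l2_sub_le _ _).trans ?_
      gcongr
      · refine (l2_add_le _ _).trans ?_
        gcongr
        · exact (l2_le_pairNorm_right _ _).trans h1
        · refine (h.Q_le x).trans ?_
          gcongr
          exact (l2_le_pairNorm_left x z).trans (hxz.le.trans hle)
      · exact (l2_le_pairNorm_right x z).trans (hxz.le.trans hle)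
    refine (l2_add_le _ _).trans ?_
    have h0 : 0 ≤ K * (I.par.CN + K * I.par.ρ + I.par.ρ) := by positivity
    have h3 : l2 I.start.y ≤ K * n := h.y0_le
    nlinarith

end Instance

/-- Pair the second equation with `u`: the first turns the `Aᵀ` term into `μ (r ⬝ᵥ v)`, and the `Q`
term has a sign. It serves twice, with the proximal residuals of a neighborhood point and with the
shifted Newton direction. -/
lemma mul_dotProduct_le_of_residual {n m : ℕ} {Q : Matrix (Fin n) (Fin n) ℝ}
    {A : Matrix (Fin m) (Fin n) ℝ} (hQ : ∀ x, 0 ≤ x ⬝ᵥ Q *ᵥ x) {μ : ℝ} {u w s : Fin n → ℝ}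
    {v r : Fin m → ℝ} (h1 : A *ᵥ u = -(μ • r)) (h2 : -(Q *ᵥ u) + Aᵀ *ᵥ v + w = μ • s) :
    μ * (r ⬝ᵥ v + s ⬝ᵥ u) ≤ u ⬝ᵥ w := by
  have h3 : w = μ • s + Q *ᵥ u - Aᵀ *ᵥ v := by rw [← h2]; abel
  have h4 : u ⬝ᵥ Aᵀ *ᵥ v = -(μ * (r ⬝ᵥ v)) := by
    rw [mulVec_transpose, dotProduct_comm, ← dotProduct_mulVec, h1, dotProduct_neg,
      dotProduct_smul, dotProduct_comm, smul_eq_mul]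
  rw [h3, dotProduct_sub, dotProduct_add, h4, dotProduct_smul, smul_eq_mul, dotProduct_comm u s]
  linarith [hQ u]

lemma const_mul_sum_le_dotProduct {p : ℕ} {u v : Fin p → ℝ} {t : ℝ} (hu : ∀ i, 0 ≤ u i)
    (hv : ∀ i, t ≤ v i) : t * ∑ i, u i ≤ u ⬝ᵥ v := by
  rw [Finset.mul_sum]
  exact Finset.sum_le_sum fun i _ => by rw [mul_comm]; exact mul_le_mul_of_nonneg_left (hv i) (hu i)

lemma dotProduct_le_of_le {p : ℕ} {u v : Fin p → ℝ} {a b : ℝ} (hu : ∀ i, 0 ≤ u i ∧ u i ≤ a)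
    (hv : ∀ i, 0 ≤ v i ∧ v i ≤ b) : u ⬝ᵥ v ≤ p * (a * b) := by
  calc u ⬝ᵥ v ≤ ∑ _i : Fin p, a * b := Finset.sum_le_sum fun i _ =>
        mul_le_mul (hu i).2 (hv i).2 (hv i).1 ((hu i).1.trans (hu i).2)
    _ = _ := by simp

namespace Instance

variable {n m : ℕ} {I : Instance n m} {K : ℝ}

/-- The fundamental estimate for points of the neighborhood. -/
lemma Bounded.fundamental_estimate (h : I.Bounded K) (hpar : I.par.Valid) {w : Triple n m}
    {ζ : Fin n → ℝ} {lam : Fin m → ℝ} (hw : w ∈ I.nbhd w.mu ζ lam) (hmu : w.mu ≤ I.mu0) :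
    ∃ (x : Fin n → ℝ) (y : Fin m → ℝ), l2 x ≤ (2 * I.par.ρ + K) * n ∧
      l2 y ≤ (2 * K + K * (I.par.CN + K * I.par.ρ + I.par.ρ)) * n ∧
      (1 - I.par.γA) / 2 * I.par.ρ * (∑ i, w.x i + ∑ i, w.z i) +
        I.par.ρ ^ 2 * ((w.y - lam) ⬝ᵥ (w.y - y) + (w.x - ζ) ⬝ᵥ (w.x - x)) ≤
      (5 * I.par.ρ ^ 2 + 4 * I.par.ρ * K) * n := by
  obtain ⟨⟨bt, ct, h1, h2, h3, h4⟩, hpos⟩ := hw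
  obtain ⟨xt, yt, zt, h5, h6, hxt, hzt, hyt⟩ := h.exists_reference hpar h3 h4
  obtain ⟨xs, ys, zs, h7, h8, hxs, hzs, hcs, hys⟩ := h.opt
  obtain ⟨-, hCN, ⟨hγ0, hγ1⟩, -, hρ⟩ := hpar
  have hK := h.one_le
  have hmu0 : I.mu0 = I.par.ρ ^ 2 := mu0_eq h.pos
  have hμ : 0 < w.mu := mu_pos_of_pos h.pos fun i => ⟨(hpos i).1, (hpos i).2.1⟩
  have hμ0 : 0 < I.mu0 := hμ.trans_le hmu
  set θ := w.mu / I.mu0 with hθ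
  set ξ := (1 - I.par.γA) / 2 * I.par.ρ with hξ
  have hξ0 : 0 < ξ := mul_pos (by linarith) hρ
  have hθ0 : 0 < θ := div_pos hμ hμ0
  have hθ1 : θ ≤ 1 := (div_le_one hμ0).2 hmu
  have hμθ : w.mu = θ * I.mu0 := by rw [hθ]; field_simp
  have hθ2 : 0 ≤ 1 - θ := by linarith
  set x := θ • xt + (1 - θ) • xs with hx
  set y := θ • yt + (1 - θ) • ys with hy
  set z := θ • zt + (1 - θ) • zs with hz
  have hAx : I.P.A *ᵥ x = I.P.b + θ • (I.bbar + bt) := by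
    rw [hx, mulVec_add, mulVec_smul, mulVec_smul, h5, h7]; module
  have hDx : -(I.P.Q *ᵥ x) + I.P.Aᵀ *ᵥ y + z = I.P.c + θ • (I.cbar + ct) := by
    have : -(I.P.Q *ᵥ x) + I.P.Aᵀ *ᵥ y + z = θ • (-(I.P.Q *ᵥ xt) + I.P.Aᵀ *ᵥ yt + zt) +
        (1 - θ) • (-(I.P.Q *ᵥ xs) + I.P.Aᵀ *ᵥ ys + zs) := by
      simp only [hx, hy, hz, mulVec_add, mulVec_smul]; module
    rw [this, h6, h8]; module
  have key := mul_dotProduct_le_of_residual (Q := I.P.Q) (A := I.P.A) h.Q_nonneg (μ := w.mu)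
    (u := w.x - x) (v := w.y - y) (w := w.z - z) (r := w.y - lam) (s := w.x - ζ)
    (by rw [mulVec_sub, hAx, ← h1]; abel)
    (by
      have : w.mu • (w.x - ζ) = -(I.P.Q *ᵥ w.x) + I.P.Aᵀ *ᵥ w.y + w.z
        - (I.P.c + θ • (I.cbar + ct)) := by rw [← h2]; abel
      rw [this, ← hDx, mulVec_sub, mulVec_sub]; abel)
  have e1 : (w.x - x) ⬝ᵥ (w.z - z) = n * w.mu - w.x ⬝ᵥ z - w.z ⬝ᵥ x + x ⬝ᵥ z := by
    rw [← mu_eq_sum w h.pos, sub_dotProduct, dotProduct_sub, dotProduct_sub, dotProduct_comm x w.z]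
    ring
  have e2 : θ * ξ * ∑ i, w.x i ≤ w.x ⬝ᵥ z :=
    const_mul_sum_le_dotProduct (fun i => (hpos i).1.le) fun i => by
      have := mul_le_mul_of_nonneg_left (hzt i).1 hθ0.le
      have := mul_nonneg hθ2 (hzs i).1
      simp only [hz, Pi.add_apply, Pi.smul_apply, smul_eq_mul]
      linarith
  have e3 : θ * ξ * ∑ i, w.z i ≤ w.z ⬝ᵥ x :=
    const_mul_sum_le_dotProduct (fun i => (hpos i).2.1.le) fun i => by
      have := mul_le_mul_of_nonneg_left (hxt i).1 hθ0.le
      have := mul_nonneg hθ2 (hxs i).1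
      simp only [hx, Pi.add_apply, Pi.smul_apply, smul_eq_mul]
      linarith
  have hxt' : ∀ i, 0 ≤ xt i ∧ xt i ≤ 2 * I.par.ρ := fun i => ⟨hξ0.le.trans (hxt i).1, (hxt i).2⟩
  have hzt' : ∀ i, 0 ≤ zt i ∧ zt i ≤ 2 * I.par.ρ := fun i => ⟨hξ0.le.trans (hzt i).1, (hzt i).2⟩
  -- Complementarity of the optimal solution removes the only term without a factor `θ`. Every term
  -- of the final inequality then carries `θ`, which cancels, so the bound does not degenerate as μ
  -- → 0.
  have e4 : x ⬝ᵥ z ≤ θ * (n * (4 * I.par.ρ ^ 2 + 4 * I.par.ρ * K)) := by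
    have d1 := dotProduct_le_of_le hxt' hzt'
    have d2 := dotProduct_le_of_le hxt' hzs
    have d3 := dotProduct_le_of_le hxs hzt'
    have : x ⬝ᵥ z = θ * (θ * (xt ⬝ᵥ zt) + (1 - θ) * (xt ⬝ᵥ zs + xs ⬝ᵥ zt)) := by
      simp only [hx, hz, add_dotProduct, dotProduct_add, smul_dotProduct, dotProduct_smul,
        smul_eq_mul, hcs]
      ring
    rw [this]
    refine mul_le_mul_of_nonneg_left ?_ hθ0.le
    have d4 : θ * (xt ⬝ᵥ zt) ≤ 1 * (n * (2 * I.par.ρ * (2 * I.par.ρ))) :=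
      (mul_le_mul_of_nonneg_left d1 hθ0.le).trans
        (mul_le_mul_of_nonneg_right hθ1 (by positivity))
    have d5 : (1 - θ) * (xt ⬝ᵥ zs + xs ⬝ᵥ zt) ≤
        1 * (n * (2 * I.par.ρ * K) + n * (K * (2 * I.par.ρ))) :=
      (mul_le_mul_of_nonneg_left (add_le_add d2 d3) hθ2).trans
        (mul_le_mul_of_nonneg_right (by linarith) (by positivity))
    linarith
  refine ⟨x, y, ?_, ?_, ?_⟩
  · refine l2_le_mul _ le_rfl (by positivity) fun i => ?_
    have a1 := mul_le_mul_of_nonneg_left (hxt' i).2 hθ0.le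
    have a2 := mul_le_mul_of_nonneg_left (hxs i).2 hθ2
    have a3 := mul_nonneg hθ0.le (hxt' i).1
    have a4 := mul_nonneg hθ2 (hxs i).1
    have a5 : θ * (2 * I.par.ρ) ≤ 1 * (2 * I.par.ρ) := by gcongr
    have a6 : (1 - θ) * K ≤ 1 * K := by gcongr; linarith
    simp only [hx, Pi.add_apply, Pi.smul_apply, smul_eq_mul]
    rw [abs_of_nonneg (by linarith)]
    linarith
  · refine (l2_add_le _ _).trans ?_
    rw [l2_smul, l2_smul, abs_of_pos hθ0, abs_of_nonneg hθ2]
    have a1 : θ * l2 yt ≤ 1 * l2 yt := mul_le_mul_of_nonneg_right hθ1 (l2_nonneg _)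
    have a2 : (1 - θ) * l2 ys ≤ 1 * l2 ys :=
      mul_le_mul_of_nonneg_right (by linarith) (l2_nonneg _)
    linarith
  · rw [e1] at key
    refine le_of_mul_le_mul_left (a := θ) ?_ hθ0
    have hn2 : (n : ℝ) * w.mu = θ * (I.par.ρ ^ 2 * n) := by rw [hμθ, hmu0]; ring
    have hk : w.mu * ((w.y - lam) ⬝ᵥ (w.y - y) + (w.x - ζ) ⬝ᵥ (w.x - x)) = θ * (I.par.ρ ^ 2 *
        ((w.y - lam) ⬝ᵥ (w.y - y) + (w.x - ζ) ⬝ᵥ (w.x - x))) := by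
      rw [hμθ, hmu0]; ring
    rw [hn2, hk] at key
    linarith

/-- The constant that bounds the dual right-hand side on the neighborhood. -/
noncomputable def dualConst (par : Params) (K : ℝ) : ℝ :=
  K + (K * par.ρ + K ^ 2 + par.ρ + K + par.CN)

lemma Bounded.l2_dual_le (h : I.Bounded K) (hpar : I.par.Valid) {μ : ℝ} {w : Triple n m}
    {ζ : Fin n → ℝ} {lam : Fin m → ℝ} (hw : w ∈ I.nbhd μ ζ lam) (hμ : 0 ≤ μ) (hmu : μ ≤ I.mu0) :
    l2 (-(I.P.Q *ᵥ w.x) + I.P.Aᵀ *ᵥ w.y + w.z - μ • (w.x - ζ)) ≤ dualConst I.par K * n := by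
  obtain ⟨⟨bt, ct, h1, h2, h3, h4⟩, -⟩ := hw
  have hρ : 0 < I.par.ρ := hpar.2.2.2.2
  have hn := h.one_le_n
  have hc := h.l2_cbar_le hρ
  have hct : l2 ct ≤ I.par.CN * n :=
    ((l2_le_pairNorm_right _ _).trans h3).trans (le_mul_of_one_le_right hpar.2.1.le hn)
  rw [h2]
  refine (l2_add_le _ _).trans ?_
  rw [l2_smul, abs_of_nonneg (div_nonneg hμ (hμ.trans hmu))]
  have h5 : μ / I.mu0 * l2 (I.cbar + ct) ≤ 1 * (l2 I.cbar + l2 ct) := by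
    have := l2_nonneg (I.cbar + ct)
    gcongr
    · exact div_le_one_of_le₀ hmu (hμ.trans hmu)
    · exact l2_add_le _ _
  rw [dualConst]
  linarith [h.c_le]

/-- The proximal estimates taken from an earlier iterate are bounded by a multiple of `n`. -/
lemma exists_anchor_bound (par : Params) (hpar : par.Valid) (K : ℝ) : ∃ K' : ℝ, 0 ≤ K' ∧
    ∀ {n m : ℕ} (I : Instance n m), I.par = par → I.Bounded K → ∀ w : Triple n m,
      w ∈ I.nbhd w.mu w.x w.y → w.mu ≤ I.mu0 → l2 w.x ≤ K' * n ∧ l2 w.y ≤ K' * n := by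
  -- For `K < 1` no instance is bounded, so any constant serves.
  by_cases hK : 1 ≤ K
  swap
  · exact ⟨0, le_rfl, fun I _ h => absurd h.one_le hK⟩
  obtain ⟨ξ, hξ⟩ : ∃ ξ, ξ = (1 - par.γA) / 2 * par.ρ := ⟨_, rfl⟩
  obtain ⟨X, hX⟩ : ∃ X, X = (5 * par.ρ ^ 2 + 4 * par.ρ * K) / ξ := ⟨_, rfl⟩
  have hρ : 0 < par.ρ := hpar.2.2.2.2
  have hCN : 0 < par.CN := hpar.2.1
  have hξ0 : 0 < ξ := by rw [hξ]; exact mul_pos (by linarith [hpar.2.2.1.2]) hρ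
  have hX0 : 0 ≤ X := by rw [hX]; positivity
  have hD : 0 ≤ dualConst par K := by rw [dualConst]; positivity
  refine ⟨X + K * (dualConst par K + K * X + X), by positivity, ?_⟩
  rintro n m I rfl h w hw hmu
  obtain ⟨x, y, -, -, hfund⟩ := h.fundamental_estimate hpar hw hmu
  -- The estimates coincide with the point itself, so the proximal terms vanish and only the
  -- coordinate sums remain.
  rw [sub_self, sub_self, zero_dotProduct, zero_dotProduct, add_zero, mul_zero, add_zero, ← hξ]
    at hfund
  have hS : ∑ i, w.x i + ∑ i, w.z i ≤ X * n := by
    rw [hX, div_mul_eq_mul_div, le_div_iff₀ hξ0]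
    linarith
  have hpos := hw.2
  have hx := l2_le_sum w.x fun i => (hpos i).1.le
  have hz := l2_le_sum w.z fun i => (hpos i).2.1.le
  have hx' : l2 w.x ≤ X * n := by linarith [l2_nonneg w.z]
  have hz' : l2 w.z ≤ X * n := by linarith [l2_nonneg w.x]
  have hmupos : 0 ≤ w.mu := (mu_pos_of_pos h.pos fun i => ⟨(hpos i).1, (hpos i).2.1⟩).le
  have hdual := h.l2_dual_le hpar hw hmupos hmu
  have hy : l2 w.y ≤ K * (dualConst I.par K + K * X + X) * n := by
    calc l2 w.y ≤ K * l2 (I.P.Aᵀ *ᵥ w.y) := h.le_At _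
      _ ≤ K * (dualConst I.par K * n + K * (X * n) + X * n) := by
        gcongr
        have : I.P.Aᵀ *ᵥ w.y = (-(I.P.Q *ᵥ w.x) + I.P.Aᵀ *ᵥ w.y + w.z - w.mu • (w.x - w.x))
          + I.P.Q *ᵥ w.x - w.z := by rw [sub_self, smul_zero]; abel
        rw [this]
        refine (l2_sub_le _ _).trans (add_le_add ((l2_add_le _ _).trans (add_le_add hdual ?_)) hz')
        exact (h.Q_le _).trans (by gcongr)
      _ = _ := by ring
  have : 0 ≤ K * (dualConst I.par K + K * X + X) * n := by positivity
  have : 0 ≤ X * n := by positivity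
  constructor <;> linarith

/-- The properties that every state of a run has. -/
structure Inv (I : Instance n m) (s : State n m) : Prop where
  mem : s.pt ∈ I.nbhd s.pt.mu s.ζ s.lam
  mu_pos : 0 < s.pt.mu
  mu_le : s.pt.mu ≤ I.mu0
  anchor : ∃ w : Triple n m, w ∈ I.nbhd w.mu w.x w.y ∧ w.mu ≤ I.mu0 ∧ s.ζ = w.x ∧ s.lam = w.y

/-- Completing the square turns a proximal term of the fundamental estimate into a bound on the
distance from the iterate `u` to its estimate `v`, up to the distance from `v` to the reference
point `w`. -/
lemma sq_sub_mul_le_dotProduct {p : ℕ} (u v w : Fin p → ℝ) :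
    l2 (u - v) ^ 2 / 2 - l2 (v - w) ^ 2 / 2 ≤ (u - v) ⬝ᵥ (u - w) := by
  have h1 : (u - v) ⬝ᵥ (u - w) = l2 (u - v) ^ 2 + (u - v) ⬝ᵥ (v - w) := by
    rw [l2_sq, ← dotProduct_add]; congr 1; abel
  have h2 := neg_le_of_abs_le (abs_dotProduct_le (u - v) (v - w))
  nlinarith [sq_nonneg (l2 (u - v) - l2 (v - w))]

/-- All iterates are bounded by a multiple of `n`. -/
lemma exists_iterate_bound (par : Params) (hpar : par.Valid) (K : ℝ) : ∃ K' : ℝ, 0 ≤ K' ∧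
    ∀ {n m : ℕ} (I : Instance n m), I.par = par → I.Bounded K → ∀ s : State n m, I.Inv s →
      l2 s.pt.x ≤ K' * n ∧ l2 s.pt.z ≤ K' * n ∧ l2 (s.pt.x - s.ζ) ≤ K' * n ∧
        l2 (s.pt.y - s.lam) ≤ K' * n := by
  by_cases hK : 1 ≤ K
  swap
  · exact ⟨0, le_rfl, fun I _ h => absurd h.one_le hK⟩
  obtain ⟨Ka, hKa, hanchor⟩ := exists_anchor_bound par hpar K
  obtain ⟨K2, hK2⟩ : ∃ K2, K2 = 5 * par.ρ ^ 2 + 4 * par.ρ * K := ⟨_, rfl⟩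
  obtain ⟨Kx, hKx⟩ : ∃ Kx, Kx = 2 * par.ρ + K := ⟨_, rfl⟩
  obtain ⟨Ky, hKy⟩ : ∃ Ky, Ky = 2 * K + K * (par.CN + K * par.ρ + par.ρ) := ⟨_, rfl⟩
  obtain ⟨R, hR⟩ : ∃ R, R = √(2 * K2 / par.ρ ^ 2 + (Ka + Kx) ^ 2 + (Ka + Ky) ^ 2) := ⟨_, rfl⟩
  have hρ : 0 < par.ρ := hpar.2.2.2.2
  have hCN : 0 < par.CN := hpar.2.1
  have hR0 : 0 ≤ R := by rw [hR]; positivity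
  have hD : 0 ≤ dualConst par K := by rw [dualConst]; positivity
  have hK20 : 0 ≤ K2 := by rw [hK2]; positivity
  obtain ⟨Z, hZ⟩ : ∃ Z, Z = dualConst par K + K * (R + Ka) + K * (R + Ka) + par.ρ ^ 2 * R :=
    ⟨_, rfl⟩
  have hZ0 : 0 ≤ Z := by rw [hZ]; positivity
  refine ⟨R + Ka + Z, by positivity, ?_⟩
  rintro n m I rfl h s hs
  obtain ⟨wa, hwa, hwamu, hζ, hlam⟩ := hs.anchor
  obtain ⟨hax, hay⟩ := hanchor I rfl h wa hwa hwamu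
  rw [← hζ] at hax
  rw [← hlam] at hay
  obtain ⟨x, y, hx, hy, hfund⟩ := h.fundamental_estimate hpar hs.mem hs.mu_le
  rw [← hK2] at hfund
  rw [← hKx] at hx
  rw [← hKy] at hy
  have hn := h.one_le_n
  have hpos := hs.mem.2
  -- Only the sign of the coordinate sums is used: the squared distances are O(n²), so bounding the
  -- sums here would give O(n²) instead of O(n).
  have hS : 0 ≤ (1 - I.par.γA) / 2 * I.par.ρ * (∑ i, s.pt.x i + ∑ i, s.pt.z i) := by
    refine mul_nonneg (mul_nonneg (by linarith [hpar.2.2.1.2]) hρ.le) (add_nonneg ?_ ?_)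
    · exact Finset.sum_nonneg fun i _ => (hpos i).1.le
    · exact Finset.sum_nonneg fun i _ => (hpos i).2.1.le
  have hp : l2 (s.lam - y) ^ 2 ≤ ((Ka + Ky) * n) ^ 2 := by
    refine pow_le_pow_left₀ (l2_nonneg _) ((l2_sub_le _ _).trans ?_) 2
    linarith
  have hq : l2 (s.ζ - x) ^ 2 ≤ ((Ka + Kx) * n) ^ 2 := by
    refine pow_le_pow_left₀ (l2_nonneg _) ((l2_sub_le _ _).trans ?_) 2
    linarith
  have hsum : l2 (s.pt.y - s.lam) ^ 2 + l2 (s.pt.x - s.ζ) ^ 2 ≤ (R * n) ^ 2 := by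
    have a1 := sq_sub_mul_le_dotProduct s.pt.y s.lam y
    have a2 := sq_sub_mul_le_dotProduct s.pt.x s.ζ x
    have a3 : (s.pt.y - s.lam) ⬝ᵥ (s.pt.y - y) + (s.pt.x - s.ζ) ⬝ᵥ (s.pt.x - x) ≤
        K2 / I.par.ρ ^ 2 * n := by
      rw [div_mul_eq_mul_div, le_div_iff₀ (by positivity)]
      linarith
    have a4 : K2 / I.par.ρ ^ 2 * n ≤ K2 / I.par.ρ ^ 2 * n ^ 2 := by
      gcongr
      exact le_self_pow₀ hn two_ne_zero
    rw [mul_pow, hR, Real.sq_sqrt (by positivity)]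
    rw [mul_pow] at hp hq
    have a5 : (2 * K2 / I.par.ρ ^ 2 + (Ka + Kx) ^ 2 + (Ka + Ky) ^ 2) * (n : ℝ) ^ 2 =
      2 * (K2 / I.par.ρ ^ 2 * n ^ 2) + (Ka + Kx) ^ 2 * n ^ 2 + (Ka + Ky) ^ 2 * n ^ 2 := by ring
    rw [a5]
    linarith
  have hRn : 0 ≤ R * n := by positivity
  have hdy : l2 (s.pt.y - s.lam) ≤ R * n :=
    le_of_sq_le_sq (by linarith [sq_nonneg (l2 (s.pt.x - s.ζ))]) hRn
  have hdx : l2 (s.pt.x - s.ζ) ≤ R * n :=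
    le_of_sq_le_sq (by linarith [sq_nonneg (l2 (s.pt.y - s.lam))]) hRn
  have hx' : l2 s.pt.x ≤ (R + Ka) * n := by
    have := l2_add_le (s.pt.x - s.ζ) s.ζ
    rw [sub_add_cancel] at this
    linarith
  have hy' : l2 s.pt.y ≤ (R + Ka) * n := by
    have := l2_add_le (s.pt.y - s.lam) s.lam
    rw [sub_add_cancel] at this
    linarith
  have hz' : l2 s.pt.z ≤ Z * n := by
    have hdual := h.l2_dual_le hpar hs.mem hs.mu_pos.le hs.mu_le
    have e : s.pt.z = (-(I.P.Q *ᵥ s.pt.x) + I.P.Aᵀ *ᵥ s.pt.y + s.pt.z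
      - s.pt.mu • (s.pt.x - s.ζ)) + I.P.Q *ᵥ s.pt.x - I.P.Aᵀ *ᵥ s.pt.y
      + s.pt.mu • (s.pt.x - s.ζ) := by abel
    rw [e]
    have b1 : l2 (I.P.Q *ᵥ s.pt.x) ≤ K * ((R + Ka) * n) := (h.Q_le _).trans (by gcongr)
    have b2 : l2 (I.P.Aᵀ *ᵥ s.pt.y) ≤ K * ((R + Ka) * n) := (h.At_le _).trans (by gcongr)
    have b3 : l2 (s.pt.mu • (s.pt.x - s.ζ)) ≤ I.par.ρ ^ 2 * (R * n) := by
      rw [l2_smul, abs_of_pos hs.mu_pos, ← mu0_eq h.pos]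
      have := hs.mu_le
      have := l2_nonneg (s.pt.x - s.ζ)
      have : 0 ≤ I.mu0 := hs.mu_pos.le.trans hs.mu_le
      gcongr
    refine (l2_add_le _ _).trans (le_trans (add_le_add ((l2_sub_le _ _).trans
      (add_le_add ((l2_add_le _ _).trans (add_le_add hdual b1)) b2)) b3) ?_)
    rw [hZ]
    linarith
  have c1 : 0 ≤ Ka * (n : ℝ) := by positivity
  have c2 : 0 ≤ Z * n := by positivity
  refine ⟨?_, ?_, ?_, ?_⟩ <;> linarith

end Instance

/-! ### Size of the Newton directions. -/

/-- Split off the shifts `a`, `b` and expand the square of `z (dx - a) + x (dz - b)`, which the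
complementarity equation controls. The cross term is kept, since only its sum over the coordinates
has a known sign. -/
lemma scaled_direction_le {x z a b dx dz γ μ σ : ℝ} (hx : 0 < x) (hz : 0 < z) (hγ : 0 < γ)
    (hμ : 0 < μ) (hσ0 : 0 ≤ σ) (hσ1 : σ ≤ 1) (hxz : γ * μ ≤ x * z)
    (h : z * dx + x * dz = -(x * z - σ * μ)) :
    z * dx ^ 2 / x + x * dz ^ 2 / z ≤ 6 * (x * z + μ / γ) +
      8 * (z ^ 2 * a ^ 2 + x ^ 2 * b ^ 2) / (γ * μ) - 4 * ((dx - a) * (dz - b)) := by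
  have hγμ : 0 < γ * μ := by positivity
  have hxz0 : 0 < x * z := by positivity
  have e1 : z * dx ^ 2 / x + x * dz ^ 2 / z = (z ^ 2 * dx ^ 2 + x ^ 2 * dz ^ 2) / (x * z) := by
    field_simp
  have e2 : z ^ 2 * dx ^ 2 + x ^ 2 * dz ^ 2 ≤ 6 * ((x * z) ^ 2 + μ ^ 2) +
      8 * (z ^ 2 * a ^ 2 + x ^ 2 * b ^ 2) - 4 * ((dx - a) * (dz - b)) * (x * z) := by
    have f1 : z ^ 2 * dx ^ 2 ≤ 2 * (z * (dx - a)) ^ 2 + 2 * (z * a) ^ 2 := by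
      nlinarith [sq_nonneg (z * (dx - a) - z * a)]
    have f2 : x ^ 2 * dz ^ 2 ≤ 2 * (x * (dz - b)) ^ 2 + 2 * (x * b) ^ 2 := by
      nlinarith [sq_nonneg (x * (dz - b) - x * b)]
    have f3 : (z * (dx - a) + x * (dz - b)) ^ 2 ≤
        3 * ((x * z - σ * μ) ^ 2 + (z * a) ^ 2 + (x * b) ^ 2) := by
      have : z * (dx - a) + x * (dz - b) = -(x * z - σ * μ) - z * a - x * b := by
        rw [← h]; ring
      rw [this]
      nlinarith [sq_nonneg ((x * z - σ * μ) - z * a), sq_nonneg ((x * z - σ * μ) - x * b),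
        sq_nonneg (z * a - x * b)]
    have f4 : (x * z - σ * μ) ^ 2 ≤ (x * z) ^ 2 + μ ^ 2 := by
      have g1 : 0 ≤ x * z * (σ * μ) := by positivity
      have g2 : (σ * μ) ^ 2 ≤ (1 * μ) ^ 2 := by gcongr
      nlinarith
    nlinarith
  rw [e1, div_le_iff₀ hxz0]
  refine e2.trans ?_
  have f5 : μ ^ 2 ≤ μ / γ * (x * z) := by
    rw [div_mul_eq_mul_div, le_div_iff₀ hγ]
    nlinarith
  have f6 : z ^ 2 * a ^ 2 + x ^ 2 * b ^ 2 ≤ (z ^ 2 * a ^ 2 + x ^ 2 * b ^ 2) / (γ * μ) * (x * z) := by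
    rw [div_mul_eq_mul_div, le_div_iff₀ hγμ]
    gcongr
  have e : (6 * (x * z + μ / γ) + 8 * (z ^ 2 * a ^ 2 + x ^ 2 * b ^ 2) / (γ * μ) -
      4 * ((dx - a) * (dz - b))) * (x * z) = 6 * ((x * z) ^ 2 + μ / γ * (x * z)) +
      8 * ((z ^ 2 * a ^ 2 + x ^ 2 * b ^ 2) / (γ * μ) * (x * z)) -
      4 * ((dx - a) * (dz - b)) * (x * z) := by ring
  rw [e]
  linarith

lemma sum_sq_mul_sq_le {p : ℕ} (u v : Fin p → ℝ) :
    ∑ i, u i ^ 2 * v i ^ 2 ≤ l2 u ^ 2 * l2 v ^ 2 := by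
  rw [l2_sq u, dotProduct, Finset.sum_mul]
  refine Finset.sum_le_sum fun i _ => ?_
  rw [← sq]
  gcongr ?_ * ?_
  rw [← sq_abs]
  gcongr
  exact abs_apply_le_l2 v i

namespace Instance

variable {n m : ℕ} {I : Instance n m} {K : ℝ}

/-- The right-hand side of the linear part of the Newton system is of the order `n μ`. -/
lemma exists_newton_rhs_bound (par : Params) (hpar : par.Valid) (K : ℝ) : ∃ K' : ℝ, 0 ≤ K' ∧
    ∀ {n m : ℕ} (I : Instance n m), I.par = par → I.Bounded K → ∀ s : State n m, I.Inv s →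
      ∀ (σ : ℝ) (d : Triple n m) (rd : Fin n → ℝ) (rp : Fin m → ℝ) (rμ : Fin n → ℝ),
      0 ≤ σ → σ ≤ 1 → I.Newton s σ d rd rp rμ → I.ResidualBound s rd rp rμ →
      l2 (I.P.A *ᵥ d.x + s.pt.mu • d.y) ≤ K' * n * s.pt.mu ∧
      l2 (-(I.P.Q *ᵥ d.x + s.pt.mu • d.x) + I.P.Aᵀ *ᵥ d.y + d.z) ≤ K' * n * s.pt.mu := by
  by_cases hK : 1 ≤ K
  swap
  · exact ⟨0, le_rfl, fun I _ h => absurd h.one_le hK⟩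
  obtain ⟨Ki, hKi, hit⟩ := exists_iterate_bound par hpar K
  have hρ : 0 < par.ρ := hpar.2.2.2.2
  have hCN : 0 < par.CN := hpar.2.1
  obtain ⟨B, hB⟩ : ∃ B, B = K * par.ρ + K ^ 2 + par.ρ + K := ⟨_, rfl⟩
  have hB0 : 0 ≤ B := by rw [hB]; positivity
  refine ⟨Ki + (B + 2 * par.CN) / par.ρ ^ 2, by positivity, ?_⟩
  rintro n m I rfl h s hs σ d rd rp rμ hσ0 hσ1 ⟨hd, hp, -⟩ ⟨-, hr, -⟩
  obtain ⟨-, -, hix, hiy⟩ := hit I rfl h s hs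
  obtain ⟨⟨bt, ct, h1, h2, h3, -⟩, -⟩ := hs.mem
  have hn := h.one_le_n
  have hμ := hs.mu_pos
  have hμ0 : I.mu0 = I.par.ρ ^ 2 := mu0_eq h.pos
  have hbb : l2 I.bbar ≤ B * n := (h.l2_bbar_le hρ).trans (by gcongr; rw [hB]; nlinarith)
  have hcb : l2 I.cbar ≤ B * n := (h.l2_cbar_le hρ).trans (by rw [hB])
  rw [hμ0] at hr
  have hr' : pairNorm rp rd ≤ s.pt.mu / I.par.ρ ^ 2 * I.par.CN := by
    refine hr.trans ?_
    have : I.par.σmin / 4 ≤ 1 := by linarith [hpar.1.2.1, hpar.1.2.2]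
    calc _ = I.par.σmin / 4 * (s.pt.mu / I.par.ρ ^ 2 * I.par.CN) := by field_simp
      _ ≤ 1 * (s.pt.mu / I.par.ρ ^ 2 * I.par.CN) := by gcongr
      _ = _ := one_mul _
  -- Substituting the neighborhood equations into the Newton system gives both blocks this shape,
  -- with proximal term `u`, initial residual `v`, perturbation `e` and inexactness `r`.
  have gen : ∀ {p : ℕ} (u v e r : Fin p → ℝ), l2 u ≤ Ki * n → l2 v ≤ B * n → l2 e ≤ I.par.CN →
      l2 r ≤ s.pt.mu / I.par.ρ ^ 2 * I.par.CN →
      l2 (((1 - σ) * s.pt.mu) • u - ((1 - σ) * (s.pt.mu / I.par.ρ ^ 2)) • v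
        - (s.pt.mu / I.par.ρ ^ 2) • e + r) ≤
        (Ki + (B + 2 * I.par.CN) / I.par.ρ ^ 2) * n * s.pt.mu := by
    intro p u v e r hu hv he hr
    have t1 : l2 (((1 - σ) * s.pt.mu) • u) ≤ 1 * s.pt.mu * (Ki * n) := by
      rw [l2_smul, abs_of_nonneg (mul_nonneg (by linarith) hμ.le)]
      have := l2_nonneg u
      gcongr
      linarith
    have t2 : l2 (((1 - σ) * (s.pt.mu / I.par.ρ ^ 2)) • v) ≤
        1 * (s.pt.mu / I.par.ρ ^ 2) * (B * n) := by
      rw [l2_smul, abs_of_nonneg (mul_nonneg (by linarith) (by positivity))]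
      have := l2_nonneg v
      gcongr
      linarith
    have t3 : l2 ((s.pt.mu / I.par.ρ ^ 2) • e) ≤ s.pt.mu / I.par.ρ ^ 2 * (I.par.CN * n) := by
      rw [l2_smul, abs_of_pos (by positivity)]
      gcongr
      exact he.trans (le_mul_of_one_le_right hCN.le hn)
    have t4 : l2 r ≤ s.pt.mu / I.par.ρ ^ 2 * (I.par.CN * n) := hr.trans (by
      gcongr
      exact le_mul_of_one_le_right hCN.le hn)
    refine ((l2_add_le _ _).trans (add_le_add ((l2_sub_le _ _).trans
      (add_le_add ((l2_sub_le _ _).trans (add_le_add t1 t2)) t3)) t4)).trans (le_of_eq ?_)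
    field_simp
    ring
  constructor
  · have e : I.P.A *ᵥ d.x + s.pt.mu • d.y = ((1 - σ) * s.pt.mu) • (s.pt.y - s.lam)
        - ((1 - σ) * (s.pt.mu / I.par.ρ ^ 2)) • I.bbar - (s.pt.mu / I.par.ρ ^ 2) • bt + rp := by
      have : I.P.A *ᵥ s.pt.x = I.P.b + (s.pt.mu / I.mu0) • (I.bbar + bt)
          - s.pt.mu • (s.pt.y - s.lam) := by rw [← h1]; abel
      rw [hp, this, hμ0]
      module
    rw [e]
    exact gen _ _ _ _ hiy hbb ((l2_le_pairNorm_left _ _).trans h3)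
      ((l2_le_pairNorm_left _ _).trans hr')
  · have e : -(I.P.Q *ᵥ d.x + s.pt.mu • d.x) + I.P.Aᵀ *ᵥ d.y + d.z =
        ((1 - σ) * s.pt.mu) • (-(s.pt.x - s.ζ))
        - ((1 - σ) * (s.pt.mu / I.par.ρ ^ 2)) • I.cbar - (s.pt.mu / I.par.ρ ^ 2) • ct + rd := by
      have : I.P.Aᵀ *ᵥ s.pt.y = I.P.c + (s.pt.mu / I.mu0) • (I.cbar + ct)
          + s.pt.mu • (s.pt.x - s.ζ) + I.P.Q *ᵥ s.pt.x - s.pt.z := by rw [← h2]; abel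
      rw [hd, this, hμ0]
      module
    rw [e]
    exact gen _ _ _ _ (by rwa [l2_neg]) hcb ((l2_le_pairNorm_right _ _).trans h3)
      ((l2_le_pairNorm_right _ _).trans hr')

set_option maxHeartbeats 1000000 in
/-- Bounds for the search directions. -/
lemma exists_direction_bound (par : Params) (hpar : par.Valid) (K : ℝ) : ∃ K' : ℝ, 0 ≤ K' ∧
    ∀ {n m : ℕ} (I : Instance n m), I.par = par → I.Bounded K → ∀ s : State n m, I.Inv s →
      ∀ (σ : ℝ) (d : Triple n m) (rd : Fin n → ℝ) (rp : Fin m → ℝ) (rμ : Fin n → ℝ),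
      0 ≤ σ → σ ≤ 1 → I.Newton s σ d rd rp rμ → I.ResidualBound s rd rp rμ →
      (∀ i, |d.x i| ≤ K' * n ^ 2 * s.pt.x i) ∧ (∀ i, |d.z i| ≤ K' * n ^ 2 * s.pt.z i) ∧
      (∀ i, |d.x i * d.z i| ≤ K' * n ^ 4 * s.pt.mu) ∧
      |d.x ⬝ᵥ d.z| ≤ K' * n ^ 4 * s.pt.mu ∧ l2 d.x ≤ K' * n ^ 3 ∧ l2 d.y ≤ K' * n ^ 3 := by
  by_cases hK : 1 ≤ K
  swap
  · exact ⟨0, le_rfl, fun I _ h => absurd h.one_le hK⟩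
  obtain ⟨Ki, hKi, hit⟩ := exists_iterate_bound par hpar K
  obtain ⟨Kr, hKr, hrhs⟩ := exists_newton_rhs_bound par hpar K
  have hρ : 0 < par.ρ := hpar.2.2.2.2
  have hγ : 0 < par.γμ := hpar.2.2.2.1.1
  obtain ⟨Ks, hKs⟩ : ∃ Ks, Ks = Kr + (K + par.ρ ^ 2) * (K * Kr) + K * Kr := ⟨_, rfl⟩
  have hKs0 : 0 ≤ Ks := by rw [hKs]; positivity
  obtain ⟨T, hT⟩ : ∃ T, T = 6 + 6 / par.γμ + 16 * (Ki ^ 2 * Ks ^ 2) / par.γμ := ⟨_, rfl⟩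
  have hT0 : 0 ≤ T := by rw [hT]; positivity
  obtain ⟨R, hR⟩ : ∃ R, R = √(T / par.γμ) := ⟨_, rfl⟩
  have hR0 : 0 ≤ R := by rw [hR]; positivity
  obtain ⟨Y, hY⟩ : ∃ Y, Y = K * (Kr * par.ρ ^ 2 + (K + par.ρ ^ 2) * (R * Ki) + R * Ki) := ⟨_, rfl⟩
  have hY0 : 0 ≤ Y := by rw [hY]; positivity
  refine ⟨T + R + R * Ki + Y, by positivity, ?_⟩
  rintro n m I rfl h s hs σ d rd rp rμ hσ0 hσ1 hN hr
  obtain ⟨hix, hiz, -, -⟩ := hit I rfl h s hs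
  obtain ⟨hrp, hrd⟩ := hrhs I rfl h s hs σ d rd rp rμ hσ0 hσ1 hN hr
  have hn := h.one_le_n
  have hμ := hs.mu_pos
  have hμ0 : I.mu0 = I.par.ρ ^ 2 := mu0_eq h.pos
  have hμle : s.pt.mu ≤ I.par.ρ ^ 2 := hμ0 ▸ hs.mu_le
  have hpos := hs.mem.2
  set Rp := I.P.A *ᵥ d.x + s.pt.mu • d.y with hRp
  set Rd := -(I.P.Q *ᵥ d.x + s.pt.mu • d.x) + I.P.Aᵀ *ᵥ d.y + d.z with hRd
  have hQμ : ∀ u : Fin n → ℝ, l2 (I.P.Q *ᵥ u + s.pt.mu • u) ≤ (K + I.par.ρ ^ 2) * l2 u := by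
    intro u
    refine (l2_add_le _ _).trans ?_
    rw [l2_smul, abs_of_pos hμ, add_mul]
    have := l2_nonneg u
    exact add_le_add (h.Q_le u) (by gcongr)
  -- The shift `(sx, 0, sz)` is a particular solution of the linear blocks. What remains solves the
  -- homogeneous system, in which `d.y` and `d.x - sx` act as proximal residuals, so their squares
  -- appear in the monotonicity bound.
  obtain ⟨sx, hsx, hsxl⟩ := h.A_surj Rp
  have hsx' : l2 sx ≤ K * Kr * (n * s.pt.mu) := by
    calc l2 sx ≤ K * l2 Rp := hsxl
      _ ≤ K * (Kr * n * s.pt.mu) := by gcongr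
      _ = _ := by ring
  set sz := Rd + (I.P.Q *ᵥ sx + s.pt.mu • sx) with hsz
  have hnμ : 0 ≤ n * s.pt.mu := by positivity
  have hsx1 : l2 sx ≤ Ks * (n * s.pt.mu) := hsx'.trans (by
    gcongr
    rw [hKs]
    have : 0 ≤ (K + I.par.ρ ^ 2) * (K * Kr) := by positivity
    linarith)
  have hsz1 : l2 sz ≤ Ks * (n * s.pt.mu) := by
    refine (l2_add_le _ _).trans ?_
    have a1 : l2 (I.P.Q *ᵥ sx + s.pt.mu • sx) ≤ (K + I.par.ρ ^ 2) * (K * Kr * (n * s.pt.mu)) :=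
      (hQμ sx).trans (by gcongr)
    have a2 : 0 ≤ K * Kr * (n * s.pt.mu) := by positivity
    rw [hKs]
    linarith
  have huw : 0 ≤ (d.x - sx) ⬝ᵥ (d.z - sz) := by
    have key := mul_dotProduct_le_of_residual (Q := I.P.Q) (A := I.P.A) h.Q_nonneg (μ := s.pt.mu)
      (u := d.x - sx) (v := d.y) (w := d.z - sz) (r := d.y) (s := d.x - sx)
      (by rw [mulVec_sub, hsx, hRp]; abel)
      (by rw [hsz, hRd, mulVec_sub]; module)
    refine le_trans (mul_nonneg hμ.le (add_nonneg ?_ ?_)) key <;>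
      exact dotProduct_self_nonneg' _
  let t : Fin n → ℝ := fun i =>
    s.pt.z i * d.x i ^ 2 / s.pt.x i + s.pt.x i * d.z i ^ 2 / s.pt.z i
  have ht0 : ∀ i, 0 ≤ t i := fun i => by
    have := (hpos i).1
    have := (hpos i).2.1
    positivity
  have hsum : ∑ i, t i ≤ T * n ^ 4 * s.pt.mu := by
    have step : ∀ i, t i ≤ 6 * (s.pt.x i * s.pt.z i + s.pt.mu / I.par.γμ) +
        8 * (s.pt.z i ^ 2 * sx i ^ 2 + s.pt.x i ^ 2 * sz i ^ 2) / (I.par.γμ * s.pt.mu)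
        - 4 * ((d.x i - sx i) * (d.z i - sz i)) := fun i => by
      refine scaled_direction_le (hpos i).1 (hpos i).2.1 hγ hμ hσ0 hσ1 (hpos i).2.2 ?_
      have := congrFun hN.2.2 i
      rw [hr.1, add_zero] at this
      exact this
    refine (Finset.sum_le_sum fun i _ => step i).trans ?_
    rw [Finset.sum_sub_distrib, Finset.sum_add_distrib, ← Finset.sum_div, ← Finset.mul_sum,
      ← Finset.mul_sum, ← Finset.mul_sum, Finset.sum_add_distrib, Finset.sum_add_distrib]
    have b1 : ∑ i, s.pt.x i * s.pt.z i = n * s.pt.mu := mu_eq_sum _ h.pos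
    have b2 : ∑ i, (d.x i - sx i) * (d.z i - sz i) = (d.x - sx) ⬝ᵥ (d.z - sz) := rfl
    have b3 : ∑ _i : Fin n, s.pt.mu / I.par.γμ = n * (s.pt.mu / I.par.γμ) := by simp
    have b4 : ∑ i, s.pt.z i ^ 2 * sx i ^ 2 ≤ (Ki * n) ^ 2 * (Ks * (n * s.pt.mu)) ^ 2 := by
      refine (sum_sq_mul_sq_le _ _).trans ?_
      have := l2_nonneg sx
      have := l2_nonneg s.pt.z
      gcongr
    have b5 : ∑ i, s.pt.x i ^ 2 * sz i ^ 2 ≤ (Ki * n) ^ 2 * (Ks * (n * s.pt.mu)) ^ 2 := by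
      refine (sum_sq_mul_sq_le _ _).trans ?_
      have := l2_nonneg sz
      have := l2_nonneg s.pt.x
      gcongr
    rw [b1, b2, b3]
    have b6 : 8 * (∑ i, s.pt.z i ^ 2 * sx i ^ 2 + ∑ i, s.pt.x i ^ 2 * sz i ^ 2)
        / (I.par.γμ * s.pt.mu) ≤ 8 * ((Ki * n) ^ 2 * (Ks * (n * s.pt.mu)) ^ 2 +
        (Ki * n) ^ 2 * (Ks * (n * s.pt.mu)) ^ 2) / (I.par.γμ * s.pt.mu) := by
      gcongr
    have b7 : 8 * ((Ki * n) ^ 2 * (Ks * (n * s.pt.mu)) ^ 2 +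
        (Ki * n) ^ 2 * (Ks * (n * s.pt.mu)) ^ 2) / (I.par.γμ * s.pt.mu) =
        16 * (Ki ^ 2 * Ks ^ 2) / I.par.γμ * n ^ 4 * s.pt.mu := by
      field_simp
      ring
    have b8 : 6 * (n * s.pt.mu + n * (s.pt.mu / I.par.γμ)) =
        (6 + 6 / I.par.γμ) * n * s.pt.mu := by
      field_simp
    have b9 : (6 + 6 / I.par.γμ) * n * s.pt.mu ≤ (6 + 6 / I.par.γμ) * n ^ 4 * s.pt.mu := by
      gcongr
      exact le_self_pow₀ hn (by norm_num)
    have b10 : T * n ^ 4 * s.pt.mu = (6 + 6 / I.par.γμ) * n ^ 4 * s.pt.mu +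
        16 * (Ki ^ 2 * Ks ^ 2) / I.par.γμ * n ^ 4 * s.pt.mu := by rw [hT]; ring
    linarith
  have hti : ∀ i, t i ≤ T * n ^ 4 * s.pt.mu := fun i =>
    (Finset.single_le_sum (f := t) (fun j _ => ht0 j) (Finset.mem_univ i)).trans hsum
  have hprod : ∀ i, |d.x i * d.z i| ≤ t i := fun i => by
    have hx := (hpos i).1
    have hz := (hpos i).2.1
    have e : t i = ((s.pt.z i * d.x i) ^ 2 + (s.pt.x i * d.z i) ^ 2) / (s.pt.x i * s.pt.z i) := by
      simp only [t]; field_simp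
    rw [e, le_div_iff₀ (by positivity)]
    have : |d.x i * d.z i| * (s.pt.x i * s.pt.z i) = |s.pt.z i * d.x i| * |s.pt.x i * d.z i| := by
      rw [abs_mul, abs_mul, abs_mul, abs_of_pos hx, abs_of_pos hz]; ring
    rw [this, ← sq_abs (s.pt.z i * d.x i), ← sq_abs (s.pt.x i * d.z i)]
    nlinarith [sq_nonneg (|s.pt.z i * d.x i| - |s.pt.x i * d.z i|),
      sq_nonneg (|s.pt.z i * d.x i|), sq_nonneg (|s.pt.x i * d.z i|)]
  -- Centrality gives `z / x ≥ γμ μ / x²`, so the factor μ cancels and the relative change `e / x`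
  -- is O(n²), uniformly in μ.
  have hrel : ∀ x z e : ℝ, 0 < x → 0 < z → I.par.γμ * s.pt.mu ≤ x * z →
      z * e ^ 2 / x ≤ T * n ^ 4 * s.pt.mu → |e| ≤ R * n ^ 2 * x := by
    intro x z e hx hz hxz hle
    refine abs_le_of_sq_le_sq ?_ (by positivity)
    rw [div_le_iff₀ hx] at hle
    have c1 : (I.par.γμ * s.pt.mu) * e ^ 2 ≤ T * n ^ 4 * s.pt.mu * x ^ 2 := by
      calc (I.par.γμ * s.pt.mu) * e ^ 2 ≤ x * z * e ^ 2 := by gcongr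
        _ = x * (z * e ^ 2) := by ring
        _ ≤ x * (T * n ^ 4 * s.pt.mu * x) := by gcongr
        _ = _ := by ring
    rw [mul_pow, mul_pow, hR, Real.sq_sqrt (by positivity)]
    have c2 : T / I.par.γμ * ((n : ℝ) ^ 2) ^ 2 * x ^ 2 =
        T * n ^ 4 * s.pt.mu * x ^ 2 / (I.par.γμ * s.pt.mu) := by field_simp
    rw [c2, le_div_iff₀ (by positivity)]
    linarith
  have hdx : ∀ i, |d.x i| ≤ R * n ^ 2 * s.pt.x i := fun i =>
    hrel _ (s.pt.z i) _ (hpos i).1 (hpos i).2.1 (hpos i).2.2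
      (le_trans (le_add_of_nonneg_right (by
        have := (hpos i).1
        have := (hpos i).2.1
        positivity)) (hti i))
  have hdz : ∀ i, |d.z i| ≤ R * n ^ 2 * s.pt.z i := fun i =>
    hrel _ (s.pt.x i) _ (hpos i).2.1 (hpos i).1 ((hpos i).2.2.trans_eq (mul_comm _ _))
      (le_trans (le_add_of_nonneg_left (by
        have := (hpos i).1
        have := (hpos i).2.1
        positivity)) (hti i))
  have hldx : l2 d.x ≤ R * Ki * n ^ 3 := by
    calc l2 d.x ≤ R * n ^ 2 * l2 s.pt.x := l2_le_l2_of_abs_le _ _ (by positivity) fun i =>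
          (hdx i).trans_eq (by rw [abs_of_pos (hpos i).1])
      _ ≤ R * n ^ 2 * (Ki * n) := by gcongr
      _ = _ := by ring
  have hldz : l2 d.z ≤ R * Ki * n ^ 3 := by
    calc l2 d.z ≤ R * n ^ 2 * l2 s.pt.z := l2_le_l2_of_abs_le _ _ (by positivity) fun i =>
          (hdz i).trans_eq (by rw [abs_of_pos (hpos i).2.1])
      _ ≤ R * n ^ 2 * (Ki * n) := by gcongr
      _ = _ := by ring
  have hldy : l2 d.y ≤ Y * n ^ 3 := by
    calc l2 d.y ≤ K * l2 (I.P.Aᵀ *ᵥ d.y) := h.le_At _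
      _ ≤ K * (Kr * n ^ 3 * I.par.ρ ^ 2 + (K + I.par.ρ ^ 2) * (R * Ki * n ^ 3)
          + R * Ki * n ^ 3) := by
        gcongr
        have e : I.P.Aᵀ *ᵥ d.y = Rd + (I.P.Q *ᵥ d.x + s.pt.mu • d.x) - d.z := by rw [hRd]; abel
        rw [e]
        refine (l2_sub_le _ _).trans (add_le_add ((l2_add_le _ _).trans (add_le_add ?_ ?_)) hldz)
        · refine hrd.trans ?_
          gcongr
          exact le_self_pow₀ hn (by norm_num)
        · exact (hQμ _).trans (by gcongr)
      _ = _ := by rw [hY]; ring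
  have hRK : 0 ≤ R * Ki := by positivity
  refine ⟨fun i => (hdx i).trans ?_, fun i => (hdz i).trans ?_,
    fun i => ((hprod i).trans (hti i)).trans ?_, ?_, hldx.trans ?_, hldy.trans ?_⟩
  · have := (hpos i).1
    gcongr
    linarith
  · have := (hpos i).2.1
    gcongr
    linarith
  · gcongr
    linarith
  · refine le_trans (Finset.abs_sum_le_sum_abs _ _) ?_
    refine ((Finset.sum_le_sum fun i _ => hprod i).trans hsum).trans ?_
    gcongr
    linarith
  · gcongr
    linarith
  · gcongr
    linarith

end Instance

/-! ### Admissibility of short steps. -/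

lemma IsResidualNorm.comb_le {m n : ℕ} {L : ℝ} {N : (Fin m → ℝ) → (Fin n → ℝ) → ℝ}
    (hN : IsResidualNorm L N) (a₁ a₂ a₃ a₄ a₅ : ℝ) (b₁ b₂ b₃ b₄ b₅ : Fin m → ℝ)
    (c₁ c₂ c₃ c₄ c₅ : Fin n → ℝ) :
    N (a₁ • b₁ + a₂ • b₂ + a₃ • b₃ + a₄ • b₄ + a₅ • b₅)
      (a₁ • c₁ + a₂ • c₂ + a₃ • c₃ + a₄ • c₄ + a₅ • c₅) ≤
      |a₁| * N b₁ c₁ + |a₂| * N b₂ c₂ + |a₃| * N b₃ c₃ + |a₄| * N b₄ c₄ + |a₅| * N b₅ c₅ := by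
  refine (hN.add_le _ _ _ _).trans (add_le_add ?_ (hN.smul_le _ _ _))
  refine (hN.add_le _ _ _ _).trans (add_le_add ?_ (hN.smul_le _ _ _))
  refine (hN.add_le _ _ _ _).trans (add_le_add ?_ (hN.smul_le _ _ _))
  exact (hN.add_le _ _ _ _).trans (add_le_add (hN.smul_le _ _ _) (hN.smul_le _ _ _))

lemma mul_le_of_le_div_add_one {a b κ : ℝ} (ha : 0 ≤ a) (hb : 0 ≤ b) (h : κ ≤ b / (a + 1)) :
    a * κ ≤ b := by
  calc a * κ ≤ a * (b / (a + 1)) := by gcongr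
    _ = a / (a + 1) * b := by ring
    _ ≤ 1 * b := by
      gcongr
      rw [div_le_one (by linarith)]
      linarith
    _ = b := one_mul b

namespace Instance

variable {n m : ℕ} {I : Instance n m} {K : ℝ}

/-- The complementarity row is solved exactly, so its sum fixes the linear term and the deviation is
purely quadratic in `α`. -/
lemma mu_move (hn : 0 < n) {s : State n m} {σ : ℝ} {d : Triple n m} {rd : Fin n → ℝ}
    {rp : Fin m → ℝ} (hN : I.Newton s σ d rd rp 0) (α : ℝ) :
    (s.pt.move α d).mu = (1 - α) * s.pt.mu + α * σ * s.pt.mu + α ^ 2 * ((d.x ⬝ᵥ d.z) / n) := by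
  have hn' : (n : ℝ) ≠ 0 := by positivity
  have h1 : s.pt.z ⬝ᵥ d.x + s.pt.x ⬝ᵥ d.z = -(n * s.pt.mu) + n * (σ * s.pt.mu) := by
    rw [← mu_eq_sum s.pt hn, dotProduct, dotProduct, dotProduct, ← Finset.sum_add_distrib]
    have : ∀ i, s.pt.z i * d.x i + s.pt.x i * d.z i =
        -(s.pt.x i * s.pt.z i) + σ * s.pt.mu := fun i => by
      have := congrFun hN.2.2 i
      simp only [Pi.add_apply, Pi.mul_apply, Pi.neg_apply, Pi.sub_apply, Pi.zero_apply] at this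
      linarith
    rw [Finset.sum_congr rfl fun i _ => this i]
    simp [Finset.sum_add_distrib]
  have h2 : (s.pt.x + α • d.x) ⬝ᵥ (s.pt.z + α • d.z) = n * s.pt.mu +
      α * (s.pt.z ⬝ᵥ d.x + s.pt.x ⬝ᵥ d.z) + α ^ 2 * (d.x ⬝ᵥ d.z) := by
    simp only [add_dotProduct, dotProduct_add, smul_dotProduct, dotProduct_smul, smul_eq_mul]
    rw [mu_eq_sum s.pt hn, dotProduct_comm d.x s.pt.z]
    ring
  rw [Triple.mu]
  change ((s.pt.x + α • d.x) ⬝ᵥ (s.pt.z + α • d.z)) / n = _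
  rw [h2, h1]
  field_simp
  ring

/-- The perturbations of the right-hand sides in the neighborhood after a step along `d`. -/
lemma residual_eq {s : State n m} {σ : ℝ} {d : Triple n m} {rd : Fin n → ℝ}
    {rp : Fin m → ℝ} (hN : I.Newton s σ d rd rp 0) {α E μ' : ℝ} {bt : Fin m → ℝ} {ct : Fin n → ℝ}
    (h1 : I.P.A *ᵥ s.pt.x + s.pt.mu • (s.pt.y - s.lam)
      = I.P.b + (s.pt.mu / I.mu0) • (I.bbar + bt))
    (h2 : -(I.P.Q *ᵥ s.pt.x) + I.P.Aᵀ *ᵥ s.pt.y + s.pt.z - s.pt.mu • (s.pt.x - s.ζ)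
      = I.P.c + (s.pt.mu / I.mu0) • (I.cbar + ct))
    (hμ' : μ' = (1 - α) * s.pt.mu + α * σ * s.pt.mu + α ^ 2 * E) :
    I.P.A *ᵥ (s.pt.move α d).x + μ' • ((s.pt.move α d).y - s.lam) =
      I.P.b + (μ' / I.mu0) • I.bbar + (((1 - α) * (s.pt.mu / I.mu0)) • bt + α • rp
        + (α * (μ' - s.pt.mu)) • d.y + (α ^ 2 * E) • (s.pt.y - s.lam)
        + (-(α ^ 2 * E / I.mu0)) • I.bbar) ∧
    -(I.P.Q *ᵥ (s.pt.move α d).x) + I.P.Aᵀ *ᵥ (s.pt.move α d).y + (s.pt.move α d).z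
        - μ' • ((s.pt.move α d).x - s.ζ) =
      I.P.c + (μ' / I.mu0) • I.cbar + (((1 - α) * (s.pt.mu / I.mu0)) • ct + α • rd
        + (α * (μ' - s.pt.mu)) • (-d.x) + (α ^ 2 * E) • (-(s.pt.x - s.ζ))
        + (-(α ^ 2 * E / I.mu0)) • I.cbar) := by
  obtain ⟨hd, hp, -⟩ := hN
  simp only [Triple.move, mulVec_add, mulVec_smul]
  constructor
  · have e1 : I.P.A *ᵥ s.pt.x = I.P.b + (s.pt.mu / I.mu0) • (I.bbar + bt)
        - s.pt.mu • (s.pt.y - s.lam) := by rw [← h1]; abel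
    have e2 : I.P.A *ᵥ d.x = -(I.P.A *ᵥ s.pt.x + (σ * s.pt.mu) • (s.pt.y - s.lam)
        - (I.P.b + (σ * s.pt.mu / I.mu0) • I.bbar)) + rp - s.pt.mu • d.y := by rw [← hp]; abel
    rw [e2, e1, hμ']
    module
  · have e1 : I.P.Aᵀ *ᵥ s.pt.y = I.P.c + (s.pt.mu / I.mu0) • (I.cbar + ct)
        + s.pt.mu • (s.pt.x - s.ζ) + I.P.Q *ᵥ s.pt.x - s.pt.z := by rw [← h2]; abel
    have e2 : I.P.Aᵀ *ᵥ d.y = -(-(I.P.c + (σ * s.pt.mu / I.mu0) • I.cbar) - I.P.Q *ᵥ s.pt.x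
        + I.P.Aᵀ *ᵥ s.pt.y + s.pt.z - (σ * s.pt.mu) • (s.pt.x - s.ζ)) + rd
        + (I.P.Q *ᵥ d.x + s.pt.mu • d.x) - d.z := by rw [← hd]; abel
    rw [e2, e1, hμ']
    module

/-- Short steps keep the perturbation within the bound `G`. -/
lemma residual_norm_le {L Kd Ki B G σ σmin μ μ0 E α : ℝ} {N : (Fin m → ℝ) → (Fin n → ℝ) → ℝ}
    {bt rp dy r bb : Fin m → ℝ} {ct rd dx t cb : Fin n → ℝ}
    (hN : IsResidualNorm L N) (hL : 0 ≤ L) (hKd : 0 ≤ Kd) (hKi : 0 ≤ Ki) (hB : 0 ≤ B)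
    (hG : 0 ≤ G) (hn : (1 : ℝ) ≤ n) (hμ : 0 < μ) (hμ0 : 0 < μ0) (hα0 : 0 < α) (hα1 : α ≤ 1)
    (hσ : σmin ≤ σ) (hσ0 : 0 ≤ σ) (hσ1 : σ ≤ 1)
    (hE : |E| * n ≤ Kd * n ^ 4 * μ) (hαE : α * |E| ≤ μ)
    (h1 : N bt ct ≤ G) (h2 : N rp rd ≤ σmin / (4 * μ0) * G * μ)
    (hdx : l2 dx ≤ Kd * n ^ 3) (hdy : l2 dy ≤ Kd * n ^ 3) (hr : l2 r ≤ Ki * n) (ht : l2 t ≤ Ki * n)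
    (hbb : l2 bb ≤ B * n) (hcb : l2 cb ≤ B * n)
    (hsmall : (4 * μ0 * L * Kd + 2 * μ0 * L * Ki * Kd + 2 * L * B * Kd + G * Kd) * (α * n ^ 4)
      ≤ 3 / 4 * σmin * G) :
    N (((1 - α) * (μ / μ0)) • bt + α • rp + (α * (((1 - α) * μ + α * σ * μ + α ^ 2 * E) - μ)) • dy
        + (α ^ 2 * E) • r + (-(α ^ 2 * E / μ0)) • bb)
      (((1 - α) * (μ / μ0)) • ct + α • rd
        + (α * (((1 - α) * μ + α * σ * μ + α ^ 2 * E) - μ)) • (-dx)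
        + (α ^ 2 * E) • (-t) + (-(α ^ 2 * E / μ0)) • cb) ≤
      ((1 - α) * μ + α * σ * μ + α ^ 2 * E) / μ0 * G := by
  refine (hN.comb_le _ _ _ _ _ _ _ _ _ _ _ _ _ _ _).trans ?_
  have n3 : N dy (-dx) ≤ L * (2 * (Kd * n ^ 4)) := by
    refine (hN.le _ _).trans ?_
    gcongr
    have : Kd * (n : ℝ) ^ 3 ≤ Kd * n ^ 4 := by
      gcongr
      norm_num
    rw [l2_neg]
    linarith
  have n4 : N r (-t) ≤ L * (2 * (Ki * n)) := by
    refine (hN.le _ _).trans ?_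
    gcongr
    rw [l2_neg]
    linarith
  have n5 : N bb cb ≤ L * (2 * (B * n)) := by
    refine (hN.le _ _).trans ?_
    gcongr
    linarith
  have a1 : |(1 - α) * (μ / μ0)| = (1 - α) * (μ / μ0) :=
    abs_of_nonneg (mul_nonneg (by linarith) (by positivity))
  have a3 : |α * (((1 - α) * μ + α * σ * μ + α ^ 2 * E) - μ)| ≤ α * (2 * (α * μ)) := by
    rw [abs_mul, abs_of_pos hα0]
    gcongr
    have e : ((1 - α) * μ + α * σ * μ + α ^ 2 * E) - μ = α * (α * E - (1 - σ) * μ) := by ring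
    rw [e, abs_mul, abs_of_pos hα0, mul_left_comm]
    gcongr
    refine (abs_sub _ _).trans ?_
    rw [abs_mul, abs_of_pos hα0, abs_of_nonneg (mul_nonneg (by linarith) hμ.le)]
    nlinarith
  have a4 : |α ^ 2 * E| = α ^ 2 * |E| := by rw [abs_mul, abs_of_nonneg (sq_nonneg α)]
  have a5 : |-(α ^ 2 * E / μ0)| = α ^ 2 * |E| / μ0 := by
    rw [abs_neg, abs_div, a4, abs_of_pos hμ0]
  have t1 : |(1 - α) * (μ / μ0)| * N bt ct ≤ (1 - α) * (μ / μ0) * G := by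
    rw [a1]
    exact mul_le_mul_of_nonneg_left h1 (mul_nonneg (by linarith) (by positivity))
  have t2 : |α| * N rp rd ≤ α * (σmin / (4 * μ0) * G * μ) := by
    rw [abs_of_pos hα0]; gcongr
  have t3 : |α * (((1 - α) * μ + α * σ * μ + α ^ 2 * E) - μ)| * N dy (-dx) ≤
      α * (2 * (α * μ)) * (L * (2 * (Kd * n ^ 4))) :=
    (mul_le_mul_of_nonneg_left n3 (abs_nonneg _)).trans
      (mul_le_mul_of_nonneg_right a3 (by positivity))
  -- The division by `n` in the average `E` compensates the factor `n` in the size of the proximal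
  -- terms, so the exponent stays 4; the same holds for the initial residuals below.
  have t4 : |α ^ 2 * E| * N r (-t) ≤ α ^ 2 * (2 * L * Ki) * (Kd * n ^ 4 * μ) := by
    rw [a4]
    calc _ ≤ α ^ 2 * |E| * (L * (2 * (Ki * n))) := by gcongr
      _ = α ^ 2 * (2 * L * Ki) * (|E| * n) := by ring
      _ ≤ _ := by gcongr
  have t5 : |-(α ^ 2 * E / μ0)| * N bb cb ≤ α ^ 2 * (2 * L * B) * (Kd * n ^ 4 * μ) / μ0 := by
    rw [a5]
    calc _ ≤ α ^ 2 * |E| / μ0 * (L * (2 * (B * n))) := by gcongr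
      _ = α ^ 2 * (2 * L * B) * (|E| * n) / μ0 := by ring
      _ ≤ _ := by gcongr
  have hE' : -(Kd * n ^ 4 * μ) ≤ E := by
    have : |E| ≤ |E| * n := le_mul_of_one_le_right (abs_nonneg _) hn
    linarith [neg_abs_le E]
  refine (add_le_add (add_le_add (add_le_add (add_le_add t1 t2) t3) t4) t5).trans ?_
  rw [div_mul_eq_mul_div _ μ0 G, le_div_iff₀ hμ0]
  have e : ((1 - α) * (μ / μ0) * G + α * (σmin / (4 * μ0) * G * μ) +
      α * (2 * (α * μ)) * (L * (2 * (Kd * n ^ 4))) + α ^ 2 * (2 * L * Ki) * (Kd * n ^ 4 * μ) +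
      α ^ 2 * (2 * L * B) * (Kd * n ^ 4 * μ) / μ0) * μ0 =
      (1 - α) * μ * G + α * (1 / 4 * σmin * G * μ) + α * μ *
        ((4 * μ0 * L * Kd + 2 * μ0 * L * Ki * Kd + 2 * L * B * Kd + G * Kd) * (α * n ^ 4))
      - α ^ 2 * G * (Kd * n ^ 4 * μ) := by
    field_simp
    ring
  -- The new budget exceeds the transported perturbation by `α σ μ G`, of which the inexactness
  -- takes a quarter of `α σmin μ G`; `hsmall` fits the quadratic terms into the other three
  -- quarters. Its summand `G * Kd` pays for a negative `E`, which shrinks the new budget.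
  rw [e]
  have f1 := mul_le_mul_of_nonneg_left hsmall (mul_nonneg hα0.le hμ.le)
  have f2 := mul_le_mul_of_nonneg_left hE' (mul_nonneg (sq_nonneg α) hG)
  have f3 : α * μ * G * σmin ≤ α * μ * G * σ := by gcongr
  linarith

set_option maxHeartbeats 1000000 in
/-- All sufficiently short steps are admissible. -/
lemma exists_stepsize (par : Params) (hpar : par.Valid) (K : ℝ) : ∃ κ : ℝ, 0 < κ ∧
    ∀ {n m : ℕ} (I : Instance n m), I.par = par → I.Bounded K → ∀ s : State n m, I.Inv s →
      ∀ d : Triple n m, I.IsDirection s d → ∀ α : ℝ, 0 < α → α ≤ κ / n ^ 4 →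
        α ∈ I.admissible s d := by
  by_cases hK : 1 ≤ K
  swap
  · exact ⟨1, one_pos, fun I _ h => absurd h.one_le hK⟩
  obtain ⟨Ki, hKi, hit⟩ := exists_iterate_bound par hpar K
  obtain ⟨Kd, hKd, hdir⟩ := exists_direction_bound par hpar K
  have hρ : 0 < par.ρ := hpar.2.2.2.2
  have hCN : 0 < par.CN := hpar.2.1
  have hγA : 0 < par.γA := hpar.2.2.1.1
  have hγ : 0 < par.γμ := hpar.2.2.2.1.1
  have hγ1 : 0 < 1 - par.γμ := by linarith [hpar.2.2.2.1.2]
  have hσm : 0 < par.σmin := hpar.1.1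
  obtain ⟨B, hB⟩ : ∃ B, B = K * par.ρ + K ^ 2 + par.ρ + K := ⟨_, rfl⟩
  have hB0 : 0 ≤ B := by rw [hB]; positivity
  obtain ⟨L, hL⟩ : ∃ L, L = 3 * K ^ 2 := ⟨_, rfl⟩
  have hL1 : 1 ≤ L := by rw [hL]; nlinarith
  have hL0 : 0 ≤ L := by linarith
  obtain ⟨M, hM⟩ : ∃ M : ℝ → ℝ, M = fun G => 4 * par.ρ ^ 2 * L * Kd + 2 * par.ρ ^ 2 * L * Ki * Kd
    + 2 * L * B * Kd + G * Kd := ⟨_, rfl⟩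
  have hM0 : ∀ G, 0 ≤ G → 0 ≤ M G := fun G hG => by rw [hM]; positivity
  have hG2 : 0 < par.γA * par.ρ := by positivity
  have hM1 := hM0 _ hCN.le
  have hM2 := hM0 _ hG2.le
  -- The value 49/100 is 1 - 1/2 - 0.01, the margin left by `σ ≤ 1/2` in the decrease of μ. The next
  -- bound is half the centrality slack: one half for `d.x i * d.z i`, one for the average `E`. The
  -- last two keep the residuals within their two budgets.
  obtain ⟨κ, hκ0, hκ1, hκ2, hκ3, hκ4, hκ5⟩ : ∃ κ : ℝ, 0 < κ ∧ κ ≤ 1 ∧ Kd * κ ≤ 49 / 100 ∧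
      Kd * κ ≤ par.σmin * (1 - par.γμ) / 2 ∧ M par.CN * κ ≤ 3 / 4 * par.σmin * par.CN ∧
      M (par.γA * par.ρ) * κ ≤ 3 / 4 * par.σmin * (par.γA * par.ρ) := by
    refine ⟨min 1 (min (49 / 100 / (Kd + 1)) (min (par.σmin * (1 - par.γμ) / 2 / (Kd + 1))
      (min (3 / 4 * par.σmin * par.CN / (M par.CN + 1))
        (3 / 4 * par.σmin * (par.γA * par.ρ) / (M (par.γA * par.ρ) + 1))))), ?_, ?_, ?_, ?_, ?_, ?_⟩
    · refine lt_min one_pos (lt_min ?_ (lt_min ?_ (lt_min ?_ ?_))) <;> positivity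
    · exact min_le_left _ _
    · exact mul_le_of_le_div_add_one hKd (by norm_num)
        ((min_le_right _ _).trans (min_le_left _ _))
    · exact mul_le_of_le_div_add_one hKd (by positivity)
        ((min_le_right _ _).trans ((min_le_right _ _).trans (min_le_left _ _)))
    · exact mul_le_of_le_div_add_one hM1 (by positivity) ((min_le_right _ _).trans
        ((min_le_right _ _).trans ((min_le_right _ _).trans (min_le_left _ _))))
    · exact mul_le_of_le_div_add_one hM2 (by positivity) ((min_le_right _ _).trans
        ((min_le_right _ _).trans ((min_le_right _ _).trans (min_le_right _ _))))
  refine ⟨κ, hκ0, ?_⟩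
  rintro n m I rfl h s hs d ⟨σ, rd, rp, rμ, hσ1, hσ2, hN, hr⟩ α hα0 hα
  have hn := h.one_le_n
  have hn0 : (0 : ℝ) < n := by linarith
  have hσle : σ ≤ 1 / 2 := hσ2.trans hpar.1.2.2
  have hσ0 : 0 < σ := hσm.trans_le hσ1
  have hμ := hs.mu_pos
  have hμ0 : I.mu0 = I.par.ρ ^ 2 := mu0_eq h.pos
  have hμ00 : 0 < I.mu0 := by rw [hμ0]; positivity
  obtain ⟨hdx, hdz, hdxz, hdot, hldx, hldy⟩ :=
    hdir I rfl h s hs σ d rd rp rμ hσ0.le (by linarith) hN hr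
  obtain ⟨-, -, hix, hiy⟩ := hit I rfl h s hs
  obtain ⟨rfl, hr1, hr2⟩ := hr
  obtain ⟨⟨bt, ct, h1, h2, h3, h4⟩, hpos⟩ := hs.mem
  have hbb : l2 I.bbar ≤ B * n := (h.l2_bbar_le hρ).trans (by gcongr; rw [hB]; nlinarith)
  have hcb : l2 I.cbar ≤ B * n := (h.l2_cbar_le hρ).trans (by rw [hB])
  have hακ : α * n ^ 4 ≤ κ := (le_div_iff₀ (by positivity)).1 hα
  have hn4 : (1 : ℝ) ≤ n ^ 4 := one_le_pow₀ hn
  have hα1 : α ≤ 1 := by nlinarith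
  set E := (d.x ⬝ᵥ d.z) / n with hEdef
  have hE : |E| * n ≤ Kd * n ^ 4 * s.pt.mu := by
    rw [hEdef, abs_div, abs_of_pos hn0, div_mul_cancel₀ _ hn0.ne']
    exact hdot
  have hE1 : |E| ≤ Kd * n ^ 4 * s.pt.mu :=
    (le_mul_of_one_le_right (abs_nonneg _) hn).trans hE
  have hscale : ∀ e : ℝ, e ≤ Kd * n ^ 4 * s.pt.mu → α * e ≤ Kd * κ * s.pt.mu := fun e he => by
    calc α * e ≤ α * (Kd * n ^ 4 * s.pt.mu) := by gcongr
      _ = Kd * (α * n ^ 4) * s.pt.mu := by ring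
      _ ≤ _ := by gcongr
  have hαE := hscale _ hE1
  have hαE1 : α * |E| ≤ 49 / 100 * s.pt.mu := hαE.trans (by gcongr)
  have hαE2 : α * |E| ≤ I.par.σmin * (1 - I.par.γμ) / 2 * s.pt.mu := hαE.trans (by gcongr)
  have hmove := mu_move h.pos hN α
  rw [← hEdef] at hmove
  have hαE3 : |α ^ 2 * E| = α * (α * |E|) := by
    rw [abs_mul, abs_of_nonneg (sq_nonneg α)]; ring
  have hαE4 := mul_le_mul_of_nonneg_left hαE1 hα0.le
  have hαE5 := mul_le_mul_of_nonneg_left hαE2 hα0.le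
  have hup := le_abs_self (α ^ 2 * E)
  have hlow := neg_abs_le (α ^ 2 * E)
  rw [hαE3] at hup hlow
  have hασμ : 0 < α * σ * s.pt.mu := by positivity
  have hαμ : 0 < α * s.pt.mu := by positivity
  have hασ : α * σ * s.pt.mu ≤ α * (1 / 2) * s.pt.mu := by gcongr
  have hμ'pos : 0 < (s.pt.move α d).mu := by
    have : α * s.pt.mu ≤ κ * s.pt.mu := by
      gcongr
      nlinarith
    have h5 : α * (I.par.σmin * (1 - I.par.γμ) / 2 * s.pt.mu) ≤ α * (σ * s.pt.mu / 2) := by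
      have : I.par.σmin * (1 - I.par.γμ) ≤ σ * 1 := by
        gcongr
        linarith
      have : I.par.σmin * (1 - I.par.γμ) / 2 * s.pt.mu ≤ σ * 1 / 2 * s.pt.mu := by gcongr
      refine mul_le_mul_of_nonneg_left ?_ hα0.le
      linarith
    have h6 : 0 ≤ (1 - α) * s.pt.mu := mul_nonneg (by linarith) hμ.le
    rw [hmove]
    linarith
  refine ⟨hα0, hα1, ?_, ⟨?_, ?_⟩⟩
  · rw [hmove]
    norm_num
    linarith
  · obtain ⟨r1, r2⟩ := residual_eq hN (α := α) (E := E) h1 h2 hmove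
    have hsm : ∀ G, 0 ≤ G → M G * κ ≤ 3 / 4 * I.par.σmin * G →
        (4 * I.mu0 * L * Kd + 2 * I.mu0 * L * Ki * Kd + 2 * L * B * Kd + G * Kd) * (α * n ^ 4)
        ≤ 3 / 4 * I.par.σmin * G := fun G hG hG' => by
      refine le_trans ?_ hG'
      have := hM0 G hG
      rw [hμ0]
      rw [hM] at this ⊢
      exact mul_le_mul_of_nonneg_left hακ this
    have hsemi := h.isResidualNorm_semiNorm
    rw [← hL] at hsemi
    have q1 := residual_norm_le (isResidualNorm_pairNorm hL1) hL0 hKd hKi hB0 hCN.le hn hμ hμ00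
      hα0 hα1 hσ1 hσ0.le (by linarith) hE (by linarith) h3 hr1 hldx hldy hiy hix hbb hcb
      (hsm _ hCN.le hκ4)
    have q2 := residual_norm_le hsemi hL0 hKd hKi hB0 hG2.le hn hμ hμ00
      hα0 hα1 hσ1 hσ0.le (by linarith) hE (by linarith) h4 (hr2.trans_eq (by ring)) hldx hldy hiy
      hix hbb hcb (hsm _ hG2.le hκ5)
    rw [← hmove] at q1 q2
    set p := ((1 - α) * (s.pt.mu / I.mu0)) • bt + α • rp
        + (α * ((s.pt.move α d).mu - s.pt.mu)) • d.y + (α ^ 2 * E) • (s.pt.y - s.lam)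
        + (-(α ^ 2 * E / I.mu0)) • I.bbar
    set q := ((1 - α) * (s.pt.mu / I.mu0)) • ct + α • rd
        + (α * ((s.pt.move α d).mu - s.pt.mu)) • (-d.x) + (α ^ 2 * E) • (-(s.pt.x - s.ζ))
        + (-(α ^ 2 * E / I.mu0)) • I.cbar
    set θ := (s.pt.move α d).mu / I.mu0 with hθ
    have hθ0 : 0 < θ := div_pos hμ'pos hμ00
    have hback : ∀ {p : ℕ} (u v : Fin p → ℝ), θ • (u + θ⁻¹ • v) = θ • u + v := fun u v => by
      rw [smul_add, smul_inv_smul₀ hθ0.ne']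
    have hscal : ∀ t G : ℝ, t ≤ θ * G → |θ⁻¹| * t ≤ G := fun t G ht => by
      rw [abs_of_pos (inv_pos.2 hθ0), inv_mul_le_iff₀ hθ0]
      exact ht
    -- The neighborhood scales its perturbations by `θ`, so the actual residuals are divided by it.
    refine ⟨θ⁻¹ • p, θ⁻¹ • q, ?_, ?_, ?_, ?_⟩
    · rw [r1, hback, add_assoc]
    · rw [r2, hback, add_assoc]
    · rw [pairNorm_smul]
      exact hscal _ _ q1
    · exact (hsemi.smul_le _ _ _).trans (hscal _ _ q2)
  · intro i
    have hx := (hpos i).1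
    have hz := (hpos i).2.1
    have hfac : α * (Kd * n ^ 2) ≤ 49 / 100 := by
      have : (n : ℝ) ^ 2 ≤ n ^ 4 := pow_le_pow_right₀ hn (by norm_num)
      calc α * (Kd * n ^ 2) ≤ α * (Kd * n ^ 4) := by gcongr
        _ = Kd * (α * n ^ 4) := by ring
        _ ≤ Kd * κ := by gcongr
        _ ≤ _ := hκ2
    have hposit : ∀ x e : ℝ, 0 < x → |e| ≤ Kd * n ^ 2 * x → 0 < x + α * e := fun x e hx he => by
      have g1 := mul_le_mul_of_nonneg_left ((neg_le_abs e).trans he) hα0.le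
      have g2 := mul_le_mul_of_nonneg_right hfac hx.le
      nlinarith
    refine ⟨hposit _ _ hx (hdx i), hposit _ _ hz (hdz i), ?_⟩
    have hcomp : s.pt.z i * d.x i + s.pt.x i * d.z i = -(s.pt.x i * s.pt.z i) + σ * s.pt.mu := by
      have := congrFun hN.2.2 i
      simp only [Pi.add_apply, Pi.mul_apply, Pi.neg_apply, Pi.sub_apply, Pi.zero_apply] at this
      linarith
    have hexp : (s.pt.move α d).x i * (s.pt.move α d).z i =
        (1 - α) * (s.pt.x i * s.pt.z i) + α * σ * s.pt.mu + α ^ 2 * (d.x i * d.z i) := by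
      have e : (s.pt.move α d).x i * (s.pt.move α d).z i = s.pt.x i * s.pt.z i +
          α * (s.pt.z i * d.x i + s.pt.x i * d.z i) + α ^ 2 * (d.x i * d.z i) := by
        simp only [Triple.move, Pi.add_apply, Pi.smul_apply, smul_eq_mul]; ring
      rw [e, hcomp]; ring
    have hq : α * |d.x i * d.z i| ≤ I.par.σmin * (1 - I.par.γμ) / 2 * s.pt.mu :=
      (hscale _ (hdxz i)).trans (by gcongr)
    have hq1 := mul_le_mul_of_nonneg_left hq hα0.le
    have hq2 := mul_le_mul_of_nonneg_left (neg_abs_le (d.x i * d.z i)) (sq_nonneg α)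
    have hq3 : (1 - α) * (I.par.γμ * s.pt.mu) ≤ (1 - α) * (s.pt.x i * s.pt.z i) :=
      mul_le_mul_of_nonneg_left (hpos i).2.2 (by linarith)
    have hq4 : I.par.γμ * (α ^ 2 * E) ≤ 1 * (α * (α * |E|)) :=
      (mul_le_mul_of_nonneg_left hup hγ.le).trans
        (mul_le_mul_of_nonneg_right (by linarith) (by positivity))
    have hq5 : I.par.σmin * (α * s.pt.mu * (1 - I.par.γμ)) ≤
        σ * (α * s.pt.mu * (1 - I.par.γμ)) := by gcongr
    rw [hexp, hmove]
    linarith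

/-! ### Invariants along a run. -/

lemma pairNorm_zero {p q : ℕ} : pairNorm (0 : Fin p → ℝ) (0 : Fin q → ℝ) = 0 := by
  simp [pairNorm]

lemma start_mem_nbhd (hn : 0 < n) (hpar : I.par.Valid) :
    I.start ∈ I.nbhd I.start.mu I.start.x I.start.y := by
  have hρ : 0 < I.par.ρ := hpar.2.2.2.2
  have hmu : I.start.mu = I.par.ρ ^ 2 := mu0_eq hn
  have hmu0 : I.mu0 = I.par.ρ ^ 2 := mu0_eq hn
  have h1 : I.par.ρ ^ 2 / I.par.ρ ^ 2 = 1 := div_self (by positivity)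
  refine ⟨⟨0, 0, ?_, ?_, ?_, ?_⟩, fun i => ⟨hρ, hρ, ?_⟩⟩
  · rw [hmu, hmu0, h1, bbar, sub_self, smul_zero]; module
  · rw [hmu, hmu0, h1, cbar, sub_self, smul_zero]; module
  · rw [pairNorm_zero]; exact hpar.2.1.le
  · have := semiNorm_le (P := I.P) (b := 0) (c := 0) (x := 0) (y := 0) (z := 0) (by simp) (by simp)
    rw [pairNorm_zero] at this
    exact this.trans (mul_nonneg hpar.2.2.1.1.le hρ.le)
  · rw [hmu]
    change _ ≤ I.par.ρ * I.par.ρ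
    nlinarith [hpar.2.2.2.1.2, mul_pos hρ hρ]

/-- With the estimates set to the point itself the proximal terms disappear, and the two test
inequalities become the neighborhood bounds after division by `μ / μ₀`. This makes each newly
adopted estimate an anchor. -/
lemma UpdateTest.mem_nbhd (h : I.Bounded K) {w : Triple n m} (hw : I.UpdateTest w)
    (hpos : ∀ i, 0 < w.x i ∧ 0 < w.z i ∧ I.par.γμ * w.mu ≤ w.x i * w.z i) (hmu : 0 < w.mu)
    (hmu0 : 0 < I.mu0) : w ∈ I.nbhd w.mu w.x w.y := by
  obtain ⟨h1, h2⟩ := hw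
  set θ := w.mu / I.mu0
  have hθ : 0 < θ := div_pos hmu hmu0
  have hscal : ∀ t G : ℝ, t ≤ G * θ → |θ⁻¹| * t ≤ G := fun t G ht => by
    rw [abs_of_pos (inv_pos.2 hθ), inv_mul_le_iff₀ hθ, mul_comm]
    exact ht
  refine ⟨⟨_, _, ?_, ?_, (pairNorm_smul θ⁻¹ _ _).le.trans (hscal _ _ h1),
    (semiNorm_smul_le h.surj θ⁻¹ _ _).trans (hscal _ _ h2)⟩, hpos⟩
  · rw [smul_add, smul_inv_smul₀ hθ.ne', sub_self, smul_zero]; abel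
  · rw [smul_add, smul_inv_smul₀ hθ.ne', sub_self, smul_zero]; abel

lemma Bounded.inv_step (h : I.Bounded K) {s s' : State n m} (hs : I.Inv s)
    (hstep : I.Step s s') : I.Inv s' := by
  obtain ⟨d, α, -, ⟨⟨hα0, -, hmu, hmem⟩, -⟩, hpt, hyes, hno⟩ := hstep
  rw [← hpt] at hmu hmem
  have hpos := hmem.2
  have hmupos : 0 < s'.pt.mu := mu_pos_of_pos h.pos fun i => ⟨(hpos i).1, (hpos i).2.1⟩
  have hle : s'.pt.mu ≤ I.mu0 := by
    have := hs.mu_le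
    have := mul_pos hα0 hs.mu_pos
    norm_num at hmu
    linarith
  by_cases ht : I.UpdateTest s'.pt
  · obtain ⟨hζ, hlam⟩ := hyes ht
    have := ht.mem_nbhd h hpos hmupos (hmupos.trans_le hle)
    exact ⟨by rwa [hζ, hlam], hmupos, hle, s'.pt, this, hle, hζ, hlam⟩
  · obtain ⟨hζ, hlam⟩ := hno ht
    exact ⟨by rwa [hζ, hlam], hmupos, hle, by rw [hζ, hlam]; exact hs.anchor⟩

lemma Bounded.inv_run (h : I.Bounded K) (hpar : I.par.Valid) {N : ℕ} {s : ℕ → State n m}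
    (hrun : I.Run N s) : ∀ k ≤ N, I.Inv (s k) := by
  intro k
  induction k with
  | zero =>
    intro _
    have hmem := start_mem_nbhd h.pos hpar
    have hρ : 0 < I.par.ρ := hpar.2.2.2.2
    rw [hrun.1]
    exact ⟨hmem, mu_pos_of_pos h.pos fun i => ⟨hρ, hρ⟩, le_rfl, I.start, hmem, le_rfl, rfl, rfl⟩
  | succ k ih =>
    intro hk
    exact h.inv_step (ih (by omega)) (hrun.2 k (by omega))

end Instance

/-! ### The iteration count. -/

lemma exp_neg_mul_le {ε C ω L : ℝ} (hε : 0 < ε) (hC : 0 < C)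
    (hL : (1 + ω) * Real.log (1 / ε) + Real.log C ≤ L) : Real.exp (-L) * (C / ε ^ ω) ≤ ε := by
  have h1 : C / ε ^ ω = Real.exp (Real.log C - Real.log ε * ω) := by
    rw [Real.exp_sub, Real.exp_log hC, Real.rpow_def_of_pos hε]
  rw [h1, ← Real.exp_add]
  refine (Real.exp_le_exp.2 ?_).trans_eq (Real.exp_log hε)
  rw [one_div, Real.log_inv] at hL
  linarith

/-- Near 0, `log (1/ε)` dominates `|log C|`, and how near does not depend on `n`; the filter `⊤` on
`n` expresses this uniformity. -/
lemma isBigO_iterationBound (κ : ℝ) {C ω : ℝ} :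
    (fun p : ℕ × ℝ => iterationBound κ C ω p.1 p.2)
      =O[⊤ ×ˢ 𝓝[>] (0 : ℝ)] (fun p : ℕ × ℝ => (p.1 : ℝ) ^ 4 * Real.log (1 / p.2)) := by
  refine IsBigO.of_bound (|1 / (0.01 * κ)| * (|1 + ω| + 1)) ?_
  have hev : ∀ᶠ ε in 𝓝[>] (0 : ℝ), |Real.log C| ≤ Real.log (1 / ε) := by
    have hmem : Set.Ioo 0 (Real.exp (-|Real.log C|)) ∈ 𝓝[>] (0 : ℝ) :=
      Ioo_mem_nhdsGT (Real.exp_pos _)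
    filter_upwards [hmem] with ε hε
    have := Real.log_le_log hε.1 hε.2.le
    rw [Real.log_exp] at this
    rw [one_div, Real.log_inv]
    linarith
  filter_upwards [hev.prod_inr ⊤] with p hp
  have h0 : 0 ≤ Real.log (1 / p.2) := (abs_nonneg _).trans hp
  have h1 : |(1 + ω) * Real.log (1 / p.2) + Real.log C| ≤ (|1 + ω| + 1) * Real.log (1 / p.2) := by
    refine (abs_add_le _ _).trans ?_
    rw [abs_mul, abs_of_nonneg h0]
    linarith
  rw [iterationBound, Real.norm_eq_abs, Real.norm_eq_abs, abs_mul, abs_mul, abs_of_nonneg h0,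
    div_eq_mul_one_div, abs_mul]
  calc |(p.1 : ℝ) ^ 4| * |1 / (0.01 * κ)| * |(1 + ω) * Real.log (1 / p.2) + Real.log C|
      ≤ |(p.1 : ℝ) ^ 4| * |1 / (0.01 * κ)| * ((|1 + ω| + 1) * Real.log (1 / p.2)) := by gcongr
    _ = _ := by ring

end IPPMM

theorem theorem3p4 (par : IPPMM.Params) (hpar : par.Valid)
    (Cy Cstar Cmin Cmax CQ Cr : ℝ) (hCy : 0 ≤ Cy) (hCstar : 0 ≤ Cstar) (hCmin : 0 < Cmin)
    (hCmax : 0 < Cmax) (hCQ : 0 < CQ) (hCr : 0 < Cr) :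
    ∃ κ : ℝ, 0 < κ ∧
      (∀ (n m : ℕ) (P : IPPMM.QP n m) (y0 : Fin m → ℝ), 0 < n →
        P.SeparableConvex → P.BoundedOptimalSolution Cstar → P.RegularData Cmin Cmax CQ Cr →
        ‖y0‖ ≤ Cy →
        ∀ (N : ℕ) (s : ℕ → IPPMM.State n m), (IPPMM.Instance.mk P par y0).Run N s →
          (∀ k ≤ N, ∀ d : IPPMM.Triple n m, (IPPMM.Instance.mk P par y0).IsDirection (s k) d →
            ∀ α : ℝ, 0 < α → α ≤ κ / (n : ℝ) ^ 4 →
              α ∈ (IPPMM.Instance.mk P par y0).admissible (s k) d) ∧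
          (∀ ε C ω : ℝ, 0 < ε → ε < 1 → 0 < C → 0 < ω →
            (IPPMM.Instance.mk P par y0).mu0 ≤ C / ε ^ ω →
            ∀ k ≤ N, IPPMM.iterationBound κ C ω n ε ≤ (k : ℝ) → (s k).pt.mu ≤ ε)) ∧
      (∀ C ω : ℝ, 0 < C → 0 < ω →
        (fun p : ℕ × ℝ => IPPMM.iterationBound κ C ω p.1 p.2)
          =O[⊤ ×ˢ 𝓝[>] (0 : ℝ)] (fun p : ℕ × ℝ => (p.1 : ℝ) ^ 4 * Real.log (1 / p.2))) := by
  obtain ⟨K, hbounded⟩ := IPPMM.Instance.exists_bounded par Cy Cstar Cmin Cmax CQ Cr hCy hCstar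
    hCmin hCmax hCQ hCr
  obtain ⟨κ, hκ, hstep⟩ := IPPMM.Instance.exists_stepsize par hpar K
  refine ⟨κ, hκ, ?_, fun C ω _ _ => IPPMM.isBigO_iterationBound κ⟩
  intro n m P y0 hn hQ hopt hreg hy0 N s hrun
  have hB := hbounded n m P y0 hn hQ hopt hreg hy0
  set I := IPPMM.Instance.mk P par y0
  have hinv := hB.inv_run hpar hrun
  have hadm : ∀ k ≤ N, ∀ d, I.IsDirection (s k) d → ∀ α : ℝ, 0 < α → α ≤ κ / (n : ℝ) ^ 4 →
      α ∈ I.admissible (s k) d := fun k hk d hd => hstep I rfl hB (s k) (hinv k hk) d hd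
  refine ⟨hadm, fun ε C ω hε _ hC _ hmu0 k hk hbound => ?_⟩
  have hn4 : 0 < (n : ℝ) ^ 4 := by positivity
  have ht : 0 < κ / (n : ℝ) ^ 4 := by positivity
  have hdecr : ∀ k ≤ N, (s k).pt.mu ≤ Real.exp (-(0.01 * (κ / (n : ℝ) ^ 4) * k)) * I.mu0 := by
    intro k
    induction k with
    | zero =>
      intro _
      rw [hrun.1]
      simp [IPPMM.Instance.mu0]
    | succ k ih =>
      intro hk
      obtain ⟨d, α, hd, ⟨hα, hmax⟩, hpt, -⟩ := hrun.2 k (by omega)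
      -- The endpoint `κ / n⁴` is itself admissible, so the largest admissible step is no shorter.
      have hα' := hmax (hadm k (by omega) d hd _ ht le_rfl)
      have hμ := (hinv k (by omega)).mu_pos
      have h1 := Real.add_one_le_exp (-(0.01 * (κ / (n : ℝ) ^ 4)))
      calc (s (k + 1)).pt.mu ≤ (1 - 0.01 * α) * (s k).pt.mu := by rw [hpt]; exact hα.2.2.1
        _ ≤ Real.exp (-(0.01 * (κ / (n : ℝ) ^ 4))) * (s k).pt.mu := by
          gcongr
          linarith
        _ ≤ Real.exp (-(0.01 * (κ / (n : ℝ) ^ 4))) *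
            (Real.exp (-(0.01 * (κ / (n : ℝ) ^ 4) * k)) * I.mu0) := by
          gcongr
          exact ih (by omega)
        _ = _ := by
          rw [← mul_assoc, ← Real.exp_add]
          push_cast
          ring_nf
  calc (s k).pt.mu ≤ Real.exp (-(0.01 * (κ / (n : ℝ) ^ 4) * k)) * I.mu0 := hdecr k hk
    _ ≤ Real.exp (-(0.01 * (κ / (n : ℝ) ^ 4) * k)) * (C / ε ^ ω) := by gcongr
    _ ≤ ε := IPPMM.exp_neg_mul_le hε hC (by
      rw [IPPMM.iterationBound, div_mul_eq_mul_div, div_le_iff₀ (by positivity)] at hbound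
      rw [mul_div_assoc', div_mul_eq_mul_div, le_div_iff₀ hn4]
      linarith)
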